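/- Let $(c_k)_{k\in\mathbb Z}$ be nonnegative real numbers, not all zero, with $\sum_k c_k<\infty$, and let $(g_k)_{k\in\mathbb Z}$ be independent, identically distributed complex Gaussian random variables with $\mathbb E\,g_k=0$, $\mathbb E\,g_k^2=0$ and $\mathbb E|g_k|^2=1$. On $\mathbb T=\mathbb R/2\pi\mathbb Z$ put $u_0(x)=\sum_{k\in\mathbb Z}c_kg_ke^{ikx}$. For $\varepsilon>0$ let $u$ be the solution of $$i\partial_tu+\partial_x^2u=\varepsilon^2|u|^2u,\qquad u|_{t=0}=u_0,$$ in the class $C([0,T];\mathcal FL^1(\mathbb T))$, on every interval $[0,T]$ on which a solution in this class exists (elsewhere the values of $u$ may be arbitrary); here $\|f\|_{\mathcal FL^1(\mathbb T)}=\sum_{n\in\mathbb Z}|\widehat f(n)|$ with $\widehat f(n)=\frac1{2\pi}\int_0^{2\pi}f(x)e^{-inx}\,dx$. Let $z_0>0$, and let $t=t(\varepsilon)\ge0$ satisfy $t(\varepsilon)=\mathcal O(\varepsilon^{-1}|\log\varepsilon|)$ as $\varepsilon\to0^+$. Then $$\lim_{\varepsilon\to0^+}\varepsilon\log\mathbb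 P\Big(\sup_{x\in\mathbb T}|u(t(\varepsilon),x)|>z_0\,\varepsilon^{-1/2}\Big)=-\frac{z_0^2}{\sum_{k\in\mathbb Z}c_k^2}.$$ -/

import Mathlib

open MeasureTheory ProbabilityTheory Filter Topology Set
open scoped ENNReal NNReal

noncomputable section

namespace WeakNLS

/-- `2π > 0`, in the form that the theory of Fourier coefficients on the circle asks for. -/
instance factTwoPiPos : Fact (0 < 2 * Real.pi) := ⟨Real.two_pi_pos⟩

/-- The torus `𝕋 = ℝ / 2πℤ`. On it `fourier n x = e^{inx}` and
`fourierCoeff f n = (2π)⁻¹ ∫_0^{2π} f(x) e^{-inx} dx`. -/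
abbrev Torus : Type := AddCircle (2 * Real.pi)

/-- The Fourier–Lebesgue norm `‖f‖_{𝓕L¹} = ∑ₙ |f̂(n)|`, with values in `[0, ∞]`. -/
def flNorm (f : Torus → ℂ) : ℝ≥0∞ := ∑' n : ℤ, ‖fourierCoeff f n‖ₑ

/-- `u` is a solution in `C([0, T]; 𝓕L¹(𝕋))` of the weakly nonlinear cubic Schrödinger equation
`i ∂ₜu + ∂ₓ²u = ε² |u|² u` with `u(0) = u₀`. The equation is required in the sense of distributions
in `x`, that is, tested against every `e^{inx}`:
`i ∂ₜû(t,n) - n² û(t,n) = ε² (|u|²u)^(t,n)` for all `n` and all `t ∈ [0, T]`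
(with one-sided derivatives at the end points). A function in `𝓕L¹(𝕋)` is continuous, so the values
of `u` are taken in `C(𝕋, ℂ)`. Nothing is required of `u` outside `[0, T]`. -/
structure IsSolution (ε T : ℝ) (u₀ : Torus → ℂ) (u : ℝ → C(Torus, ℂ)) : Prop where
  initial : ∀ x, u 0 x = u₀ x
  finite_flNorm : ∀ t ∈ Icc 0 T, flNorm (u t) < ∞
  continuous_flNorm : ∀ t ∈ Icc 0 T,
    Tendsto (fun s => flNorm (fun x => u s x - u t x)) (𝓝[Icc 0 T] t) (𝓝 0)
  equation : ∀ t ∈ Icc 0 T, ∀ n : ℤ, ∃ d : ℂ,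
    HasDerivWithinAt (fun s => fourierCoeff (u s) n) d (Icc 0 T) t ∧
      Complex.I * d - (n : ℂ) ^ 2 * fourierCoeff (u t) n
        = (ε : ℂ) ^ 2 * fourierCoeff (fun x => (‖u t x‖ : ℂ) ^ 2 * u t x) n

/-- `u` is the solution with initial datum `u₀`, followed for as long as one exists:
on each interval `[0, T]` on which the Cauchy problem has a solution in `C([0, T]; 𝓕L¹(𝕋))`,
`u` is one. In particular every global solution has this property. -/
def IsMaximalSolution (ε : ℝ) (u₀ : Torus → ℂ) (u : ℝ → C(Torus, ℂ)) : Prop :=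
  ∀ T : ℝ, 0 ≤ T → (∃ v, IsSolution ε T u₀ v) → IsSolution ε T u₀ u

/-- The law of a standard complex Gaussian `g`: its real and imaginary parts are independent
`N(0, 1/2)`, so that `𝔼 g = 0`, `𝔼 g² = 0` and `𝔼 |g|² = 1`. -/
def stdComplexGaussian : Measure ℂ :=
  ((gaussianReal 0 (1 / 2)).prod (gaussianReal 0 (1 / 2))).map
    (fun p : ℝ × ℝ => (p.1 : ℂ) + (p.2 : ℂ) * Complex.I)

/-- The initial datum `u₀(x) = ∑ₖ cₖ gₖ e^{ikx}`. For `(cₖ) ∈ ℓ¹` and Gaussian `gₖ` the series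
converges absolutely almost surely. -/
def initialDatum (c : ℤ → ℝ) (g : ℤ → ℂ) (x : Torus) : ℂ :=
  ∑' k : ℤ, (c k : ℂ) * g k * fourier k x

end WeakNLS

end

open MeasureTheory ProbabilityTheory Filter Topology Set
open scoped ENNReal NNReal

noncomputable section

namespace WeakNLS

/-! Dynamics. The coefficients a_k(t) = e^{itk²} û(t,k) satisfy i a_k' = ε² Σ e^{itθ} a_i conj(a_j)
a_{k-i+j} with θ = 2(k-i)(i-j). The resonant terms θ = 0 add up to (2M - |a_k|²) a_k, where M is the
mass: a real multiple of a_k, which only turns its phase. All other θ are integers of modulus at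
least 1, so there are no small divisors, and one integration by parts bounds their total effect in
ℓ¹ by ε²(2R³ + 6ε²R⁵t) while the norm is at most R (`tsum_enorm_gauge_mul_sub_le`). For R of order
ε^{-1/2} this is o(ε^{-1/2}); a bootstrap then yields existence up to time t and almost frozen
moduli. If moreover t = o(ε^{-3/2}), the phases are known too: up to a global phase and o(ε^{-1/2}),
u(t,0) is Σ c_k e^{iφ_k(|g_k|)} g_k with φ_k(x) = -tk² + ε²t(c_k x)² (`eventually_approx`).

Upper bound. The supremum is at most the 𝓕L¹ norm, which is almost conserved, so a large value
forces Σ c_k|g_k| to be large at time 0. Since 𝔼 e^{s|g|} ≤ e^{bs²+Cs} for every b > 1/4, Chernoff's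
inequality gives the rate a²/Σc_k² (`exists_mgf_bound`, `eventually_tail_le`).

Lower bound. The Gaussian law is invariant under rotation by an angle depending on the modulus
(`stdComplexGaussian_twist`), so the rotated variables e^{iφ_k(|g_k|)} g_k are again independent
standard Gaussians. Asking their real parts to exceed multiples of c_k, the optimal profile by
Cauchy-Schwarz, has the same exponential cost (`aligned_ge`). Data of too large 𝓕L¹ norm, where
nothing is known of u, and large contributions of the remaining modes are exponentially rarer. -/

/-! ### The sequence space ℓ¹(ℤ). -/

/-- The Banach space `ℓ¹(ℤ)` of absolutely summable Fourier coefficients. -/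
abbrev Ell1 : Type := lp (fun _ : ℤ => ℂ) 1

lemma norm_eq_tsum (a : Ell1) : ‖a‖ = ∑' k, ‖a k‖ := by
  rw [lp.norm_eq_tsum_rpow (by simp)]; simp

lemma summable_norm_ell1 (a : Ell1) : Summable fun k => ‖a k‖ := by
  simpa using (memℓp_gen_iff (p := 1) (by simp)).1 (lp.memℓp a)

lemma tsum_enorm_eq (a : Ell1) : ∑' k, ‖a k‖ₑ = ‖a‖ₑ := by
  rw [← ofReal_norm, norm_eq_tsum,
    ENNReal.ofReal_tsum_of_nonneg (fun _ => norm_nonneg _) (summable_norm_ell1 a)]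
  simp

lemma memℓp_one_of_tsum_enorm {f : ℤ → ℂ} (h : ∑' k, ‖f k‖ₑ ≠ ∞) :
    Memℓp (E := fun _ : ℤ => ℂ) f 1 := by
  refine memℓp_gen ?_
  have := ENNReal.summable_toReal h
  simpa using this

lemma summable_norm_of_tsum_enorm {ι : Type*} {f : ι → ℂ} (h : ∑' k, ‖f k‖ₑ ≠ ∞) :
    Summable fun k => ‖f k‖ := by
  simpa using ENNReal.summable_toReal h

lemma enorm_tsum_le {ι : Type*} (f : ι → ℂ) : ‖∑' i, f i‖ₑ ≤ ∑' i, ‖f i‖ₑ := by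
  by_cases h : ∑' i, ‖f i‖ₑ = ∞
  · simp [h]
  · have hs := summable_norm_of_tsum_enorm h
    rw [← ofReal_norm]
    refine (ENNReal.ofReal_le_ofReal (norm_tsum_le_tsum_norm hs)).trans ?_
    rw [ENNReal.ofReal_tsum_of_nonneg (fun _ => norm_nonneg _) hs]
    simp

lemma enorm_le_iff_tsum_enorm_le (a : Ell1) {C : ℝ} (hC : 0 ≤ C) :
    ‖a‖ ≤ C ↔ ∑' k, ‖a k‖ₑ ≤ ENNReal.ofReal C := by
  rw [tsum_enorm_eq, ← ofReal_norm, ENNReal.ofReal_le_ofReal_iff hC]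

/-- Tonelli in [0, ∞]: for fixed p the map k ↦ k - p.1 + p.2 is a translation of ℤ. Every trilinear
ℓ¹ bound below reduces to this identity. -/
lemma tsum_tsum_conv (A B C : ℤ → ℝ≥0∞) :
    ∑' k : ℤ, ∑' p : ℤ × ℤ, A p.1 * B p.2 * C (k - p.1 + p.2)
      = (∑' k, A k) * (∑' k, B k) * ∑' k, C k := by
  rw [ENNReal.tsum_comm]
  have h : ∀ p : ℤ × ℤ, ∑' k : ℤ, A p.1 * B p.2 * C (k - p.1 + p.2)
      = A p.1 * B p.2 * ∑' k, C k := by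
    intro p
    rw [ENNReal.tsum_mul_left]
    congr 1
    have := (Equiv.addRight (p.2 - p.1)).tsum_eq C
    rw [← this]
    congr 1; ext k; congr 1; simp; ring
  simp_rw [h]
  rw [ENNReal.tsum_mul_right, ENNReal.tsum_prod']
  simp_rw [ENNReal.tsum_mul_left, ENNReal.tsum_mul_right]

/-! ### The cubic nonlinearity in the interaction picture. -/

/-- The resonance function `k² - i² + j² - (k - i + j)²`, for `p = (i, j)`. -/
def resonance (k : ℤ) (p : ℤ × ℤ) : ℤ := 2 * (k - p.1) * (p.1 - p.2)

lemma resonance_eq (k : ℤ) (p : ℤ × ℤ) :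
    resonance k p = k ^ 2 - p.1 ^ 2 + p.2 ^ 2 - (k - p.1 + p.2) ^ 2 := by
  unfold resonance; ring

/-- The oscillating factor `e^{i s θ}` with integer frequency `θ`. -/
def osc (s : ℝ) (n : ℤ) : ℂ := Complex.exp (((s * n : ℝ) : ℂ) * Complex.I)

@[simp] lemma norm_osc (s : ℝ) (n : ℤ) : ‖osc s n‖ = 1 := Complex.norm_exp_ofReal_mul_I _

@[simp] lemma enorm_osc (s : ℝ) (n : ℤ) : ‖osc s n‖ₑ = 1 := by
  rw [← ofReal_norm]; simp

@[fun_prop] lemma continuous_osc (n : ℤ) : Continuous fun s => osc s n := by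
  unfold osc; fun_prop

/-- A single interaction of the cubic nonlinearity in the interaction picture. -/
def interaction (s : ℝ) (a b c : ℤ → ℂ) (k : ℤ) (p : ℤ × ℤ) : ℂ :=
  osc s (resonance k p) * (a p.1 * (starRingEnd ℂ) (b p.2) * c (k - p.1 + p.2))

lemma enorm_interaction (s : ℝ) (a b c : ℤ → ℂ) (k : ℤ) (p : ℤ × ℤ) :
    ‖interaction s a b c k p‖ₑ = ‖a p.1‖ₑ * ‖b p.2‖ₑ * ‖c (k - p.1 + p.2)‖ₑ := by
  simp [interaction, enorm_mul]

lemma tsum_tsum_enorm_interaction (s : ℝ) (a b c : Ell1) :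
    ∑' k : ℤ, ∑' p, ‖interaction s a b c k p‖ₑ = ‖a‖ₑ * ‖b‖ₑ * ‖c‖ₑ := by
  simp_rw [enorm_interaction]
  rw [tsum_tsum_conv (fun k => ‖a k‖ₑ) (fun k => ‖b k‖ₑ) (fun k => ‖c k‖ₑ)]
  simp_rw [tsum_enorm_eq]

lemma tsum_enorm_interaction_ne_top (s : ℝ) (a b c : Ell1) (k : ℤ) :
    ∑' p, ‖interaction s a b c k p‖ₑ ≠ ∞ := by
  refine ne_top_of_le_ne_top ?_ (ENNReal.le_tsum k |>.trans_eq
    (tsum_tsum_enorm_interaction s a b c))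
  simp [ENNReal.mul_eq_top]

lemma summable_interaction (s : ℝ) (a b c : Ell1) (k : ℤ) :
    Summable (interaction s a b c k) :=
  (summable_norm_of_tsum_enorm (tsum_enorm_interaction_ne_top s a b c k)).of_norm

/-- The cubic nonlinearity in the interaction picture, as a sequence. -/
def cubic (s : ℝ) (a b c : ℤ → ℂ) (k : ℤ) : ℂ := ∑' p, interaction s a b c k p

lemma tsum_enorm_cubic_le (s : ℝ) (a b c : Ell1) :
    ∑' k, ‖cubic s a b c k‖ₑ ≤ ‖a‖ₑ * ‖b‖ₑ * ‖c‖ₑ :=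
  (ENNReal.tsum_le_tsum fun _ => enorm_tsum_le _).trans_eq (tsum_tsum_enorm_interaction s a b c)

/-- The trilinear form as an element of `ℓ¹`. -/
def cubicEll1 (s : ℝ) (a b c : Ell1) : Ell1 :=
  ⟨cubic s a b c, memℓp_one_of_tsum_enorm
    (ne_top_of_le_ne_top (by simp [ENNReal.mul_eq_top]) (tsum_enorm_cubic_le s a b c))⟩

@[simp] lemma cubicEll1_apply (s : ℝ) (a b c : Ell1) (k : ℤ) :
    cubicEll1 s a b c k = cubic s a b c k := rfl

lemma norm_cubicEll1_le (s : ℝ) (a b c : Ell1) : ‖cubicEll1 s a b c‖ ≤ ‖a‖ * ‖b‖ * ‖c‖ := by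
  rw [enorm_le_iff_tsum_enorm_le _ (by positivity)]
  refine (tsum_enorm_cubic_le s a b c).trans_eq ?_
  rw [ENNReal.ofReal_mul (by positivity), ENNReal.ofReal_mul (by positivity)]
  simp

/-- Telescoping: the form is additive in each of its three slots. -/
lemma cubicEll1_sub (s : ℝ) (a b : Ell1) :
    cubicEll1 s a a a - cubicEll1 s b b b
      = cubicEll1 s (a - b) a a + cubicEll1 s b (a - b) a + cubicEll1 s b b (a - b) := by
  ext k
  simp only [lp.coeFn_sub, lp.coeFn_add, Pi.sub_apply, Pi.add_apply, cubicEll1_apply, cubic]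
  have e := fun x y z => summable_interaction s x y z k
  have e1 := e (a - b) a a
  have e2 := e b (a - b) a
  have e3 := e b b (a - b)
  rw [lp.coeFn_sub] at e1 e2 e3
  rw [← (e a a a).tsum_sub (e b b b), ← e1.tsum_add e2, ← (e1.add e2).tsum_add e3]
  congr 1; ext p
  simp only [interaction, Pi.sub_apply, map_sub]
  ring

lemma norm_cubicEll1_sub_le (s : ℝ) (a b : Ell1) {R : ℝ} (ha : ‖a‖ ≤ R) (hb : ‖b‖ ≤ R) :
    ‖cubicEll1 s a a a - cubicEll1 s b b b‖ ≤ 3 * R ^ 2 * ‖a - b‖ := by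
  have hR : 0 ≤ R := (norm_nonneg a).trans ha
  rw [cubicEll1_sub]
  have h1 := norm_cubicEll1_le s (a - b) a a
  have h2 := norm_cubicEll1_le s b (a - b) a
  have h3 := norm_cubicEll1_le s b b (a - b)
  have g1 : ‖a - b‖ * ‖a‖ * ‖a‖ ≤ ‖a - b‖ * R * R := by gcongr
  have g2 : ‖b‖ * ‖a - b‖ * ‖a‖ ≤ R * ‖a - b‖ * R := by gcongr
  have g3 : ‖b‖ * ‖b‖ * ‖a - b‖ ≤ R * R * ‖a - b‖ := by gcongr
  have := norm_add₃_le (a := cubicEll1 s (a - b) a a) (b := cubicEll1 s b (a - b) a)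
    (c := cubicEll1 s b b (a - b))
  linarith

lemma continuous_cubic (a b c : Ell1) (k : ℤ) : Continuous fun s => cubic s a b c k := by
  unfold cubic
  refine continuous_tsum (u := fun p => ‖interaction 0 a b c k p‖) ?_ ?_ ?_
  · intro p; unfold interaction; fun_prop
  · exact (summable_interaction 0 a b c k).norm
  · intro p s; simp [interaction]

/-- Time enters only through unimodular factors, so the absolute sums at time 0 dominate at all
times, and dominated convergence applies in k. -/
lemma continuous_cubicEll1_time (a b c : Ell1) : Continuous fun s => cubicEll1 s a b c := by
  rw [continuous_iff_continuousAt]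
  intro t
  rw [ContinuousAt, tendsto_iff_norm_sub_tendsto_zero]
  simp_rw [norm_eq_tsum]
  have hz : (0 : ℝ) = ∑' k : ℤ, (0 : ℝ) := by simp
  rw [hz]
  have hsum : Summable fun k : ℤ => ∑' p, ‖interaction 0 a b c k p‖ := by
    have h : ∑' k : ℤ, ∑' p, ‖interaction 0 a b c k p‖ₑ ≠ ∞ := by
      rw [tsum_tsum_enorm_interaction]; simp [ENNReal.mul_eq_top]
    have h2 := ENNReal.summable_toReal h
    refine h2.congr fun k => ?_
    rw [ENNReal.tsum_toReal_eq (by simp)]; simp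
  have hle : ∀ (s : ℝ) (k : ℤ), ‖cubic s a b c k‖ ≤ ∑' p, ‖interaction 0 a b c k p‖ := by
    intro s k
    refine (norm_tsum_le_tsum_norm (summable_interaction s a b c k).norm).trans_eq ?_
    congr 1; ext p; simp [interaction]
  refine tendsto_tsum_of_dominated_convergence (hsum.mul_left 2) ?_ ?_
  · intro k
    have := ((continuous_cubic a b c k).tendsto t).sub_const (cubic t a b c k)
    simpa using this.norm
  · filter_upwards with s k
    simp only [lp.coeFn_sub, Pi.sub_apply, cubicEll1_apply, norm_norm]
    refine (norm_sub_le _ _).trans ?_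
    linarith [hle s k, hle t k]

/-- Continuity in time for a fixed sequence, combined with a Lipschitz bound on balls that is
uniform in time. -/
lemma continuous_cubicEll1 : Continuous fun q : ℝ × Ell1 => cubicEll1 q.1 q.2 q.2 q.2 := by
  rw [continuous_iff_continuousAt]
  rintro ⟨t, a⟩
  have h : ContinuousOn (Function.uncurry fun (s : ℝ) (x : Ell1) => cubicEll1 s x x x)
      (univ ×ˢ Metric.ball 0 (‖a‖ + 1)) := by
    refine continuousOn_prod_of_continuousOn_lipschitzOnWith' _
      (Real.toNNReal (3 * (‖a‖ + 1) ^ 2)) ?_ ?_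
    rotate_left
    · intro x _; exact (continuous_cubicEll1_time x x x).continuousOn
    · intro s _
      refine LipschitzOnWith.of_dist_le_mul fun x hx y hy => ?_
      rw [dist_eq_norm, dist_eq_norm, Real.coe_toNNReal _ (by positivity)]
      rw [mem_ball_zero_iff] at hx hy
      exact norm_cubicEll1_sub_le s x y hx.le hy.le
  refine h.continuousAt (prod_mem_nhds univ_mem (Metric.isOpen_ball.mem_nhds ?_))
  simp

/-! ### Truncation and existence for the truncated equation. -/

/-- The radial retraction of `ℓ¹` onto the ball of radius `R`. -/
def retract (R : ℝ) (a : Ell1) : Ell1 := (R / max R ‖a‖) • a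

lemma retract_of_le {R : ℝ} (hR : 0 < R) {a : Ell1} (h : ‖a‖ ≤ R) : retract R a = a := by
  rw [retract, max_eq_left h, div_self hR.ne', one_smul]

lemma norm_retract_le {R : ℝ} (hR : 0 < R) (a : Ell1) : ‖retract R a‖ ≤ R := by
  have hm : 0 < max R ‖a‖ := lt_max_of_lt_left hR
  rw [retract, norm_smul, Real.norm_of_nonneg (by positivity), div_mul_eq_mul_div,
    div_le_iff₀ hm]
  gcongr; exact le_max_right _ _

/-- The difference splits into a change of vector and a change of scaling factor; each costs at most
‖a - b‖, whence the constant 2. -/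
lemma norm_retract_sub_le {R : ℝ} (hR : 0 < R) (a b : Ell1) :
    ‖retract R a - retract R b‖ ≤ 2 * ‖a - b‖ := by
  set m := max R ‖a‖ with hm
  set n := max R ‖b‖ with hn
  have hm0 : 0 < m := lt_max_of_lt_left hR
  have hn0 : 0 < n := lt_max_of_lt_left hR
  have e : retract R a - retract R b = (R / m) • (a - b) + (R / m - R / n) • b := by
    simp only [retract, ← hm, ← hn]
    module
  have hmn : |n - m| ≤ ‖a - b‖ := by
    have := abs_max_sub_max_le_max R ‖b‖ R ‖a‖
    refine this.trans ?_
    simp only [sub_self, abs_zero, max_le_iff, norm_nonneg, true_and]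
    rw [norm_sub_rev]; exact abs_norm_sub_norm_le b a
  have h1 : R / m ≤ 1 := (div_le_one hm0).2 (le_max_left _ _)
  have h2 : ‖b‖ / n ≤ 1 := (div_le_one hn0).2 (le_max_right _ _)
  have h3 : ‖(R / m - R / n) • b‖ ≤ ‖a - b‖ := by
    have : R / m - R / n = (R / m) * ((n - m) / n) := by field_simp
    rw [norm_smul, this, Real.norm_eq_abs, abs_mul, abs_div (n - m), abs_of_pos hn0,
      abs_of_nonneg (div_nonneg hR.le hm0.le)]
    calc R / m * (|n - m| / n) * ‖b‖ = (R / m) * |n - m| * (‖b‖ / n) := by ring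
      _ ≤ 1 * ‖a - b‖ * 1 := by gcongr
      _ = ‖a - b‖ := by ring
  have h4 : ‖(R / m) • (a - b)‖ ≤ ‖a - b‖ := by
    rw [norm_smul, Real.norm_of_nonneg (by positivity)]
    exact mul_le_of_le_one_left (norm_nonneg _) h1
  rw [e]
  linarith [norm_add_le ((R / m) • (a - b)) ((R / m - R / n) • b)]

/-- The vector field of the Schrödinger equation in the interaction picture. -/
def field (κ s : ℝ) (a : Ell1) : Ell1 := (-(Complex.I * κ)) • cubicEll1 s a a a

/-- Global existence for the equation with truncated nonlinearity. -/
lemma exists_truncated_solution {κ R T : ℝ} (hκ : 0 ≤ κ) (hR : 0 < R) (hT : 0 ≤ T) (a₀ : Ell1) :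
    ∃ a : ℝ → Ell1, a 0 = a₀ ∧
      ∀ t ∈ Icc 0 T, HasDerivWithinAt a (field κ t (retract R (a t))) (Icc 0 T) t := by
  -- The truncated field is bounded by κR³ everywhere, so a ball of radius κR³T suffices for all of
  -- [0, T]. The Lipschitz constant 6κR² is 3κR² from the cubic form times 2 from the retraction.
  have key : IsPicardLindelof (fun s a => field κ s (retract R a))
      (tmin := 0) (tmax := T) ⟨0, by simp [hT]⟩ a₀ (Real.toNNReal (κ * R ^ 3 * T)) 0
      (Real.toNNReal (κ * R ^ 3)) (Real.toNNReal (6 * κ * R ^ 2)) := by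
    constructor
    · intro s _
      refine LipschitzOnWith.of_dist_le_mul fun x _ y _ => ?_
      rw [dist_eq_norm, dist_eq_norm, Real.coe_toNNReal _ (by positivity)]
      have h := norm_cubicEll1_sub_le s _ _ (norm_retract_le hR x) (norm_retract_le hR y)
      have h2 := norm_retract_sub_le hR x y
      simp only [field]
      rw [← smul_sub, norm_smul]
      simp only [norm_neg, norm_mul, Complex.norm_I, one_mul, Complex.norm_real,
        Real.norm_of_nonneg hκ]
      calc _ ≤ κ * (3 * R ^ 2 * (2 * ‖x - y‖)) := by
              refine mul_le_mul_of_nonneg_left (h.trans ?_) hκ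
              gcongr
        _ = _ := by ring
    · intro x _
      exact ((continuous_cubicEll1_time _ _ _).const_smul (-(Complex.I * (κ : ℂ)))).continuousOn
    · intro s _ x _
      have h := norm_cubicEll1_le s (retract R x) (retract R x) (retract R x)
      have h1 := norm_retract_le hR x
      simp only [field]
      rw [Real.coe_toNNReal _ (by positivity), norm_smul]
      simp only [norm_neg, norm_mul, Complex.norm_I, one_mul, Complex.norm_real,
        Real.norm_of_nonneg hκ]
      refine mul_le_mul_of_nonneg_left (h.trans ?_) hκ
      calc _ ≤ R * R * R := by gcongr
        _ = R ^ 3 := by ring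
    · simp [Real.coe_toNNReal _ (show 0 ≤ κ * R ^ 3 * T by positivity),
        Real.coe_toNNReal _ (show 0 ≤ κ * R ^ 3 by positivity), hT]
  exact key.exists_eq_forall_mem_Icc_hasDerivWithinAt₀


/-! ### Mass and resonant interactions. -/

lemma norm_coord_le (a : Ell1) (k : ℤ) : ‖a k‖ ≤ ‖a‖ := lp.norm_apply_le_norm one_ne_zero a k

lemma continuous_coord (k : ℤ) : Continuous fun a : Ell1 => a k :=
  (lp.lipschitzWith_one_eval (E := fun _ : ℤ => ℂ) 1 k).continuous

/-- The `L²` mass. -/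
def mass (a : Ell1) : ℝ := ∑' k, ‖a k‖ ^ 2

lemma norm_sq_coord_le (a : Ell1) (k : ℤ) : ‖a k‖ ^ 2 ≤ ‖a‖ * ‖a k‖ := by
  rw [sq]; gcongr; exact norm_coord_le a k

lemma summable_sq (a : Ell1) : Summable fun k => ‖a k‖ ^ 2 :=
  Summable.of_nonneg_of_le (fun _ => sq_nonneg _) (norm_sq_coord_le a)
    ((summable_norm_ell1 a).mul_left ‖a‖)

lemma mass_nonneg (a : Ell1) : 0 ≤ mass a := tsum_nonneg fun _ => sq_nonneg _

lemma mass_le (a : Ell1) : mass a ≤ ‖a‖ ^ 2 := by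
  refine ((summable_sq a).tsum_le_tsum (norm_sq_coord_le a)
    ((summable_norm_ell1 a).mul_left ‖a‖)).trans_eq ?_
  rw [tsum_mul_left, ← norm_eq_tsum, sq]

lemma abs_mass_sub_le (a b : Ell1) : |mass a - mass b| ≤ (‖a‖ + ‖b‖) * ‖a - b‖ := by
  rw [mass, mass, ← (summable_sq a).tsum_sub (summable_sq b), norm_eq_tsum (a - b),
    ← tsum_mul_left]
  rw [← Real.norm_eq_abs]
  refine tsum_of_norm_bounded ((summable_norm_ell1 (a - b)).mul_left _).hasSum fun k => ?_
  have h1 := norm_coord_le a k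
  have h2 := norm_coord_le b k
  have h3 : |‖a k‖ - ‖b k‖| ≤ ‖(a - b) k‖ := abs_norm_sub_norm_le _ _
  rw [Real.norm_eq_abs, sq_sub_sq, abs_mul, abs_of_nonneg (by positivity)]
  gcongr

lemma continuous_mass : Continuous mass := by
  rw [continuous_iff_continuousAt]
  intro a
  rw [ContinuousAt, tendsto_iff_norm_sub_tendsto_zero]
  have h : Tendsto (fun b : Ell1 => (‖b‖ + ‖a‖) * ‖b - a‖) (𝓝 a) (𝓝 0) := by
    have : Continuous fun b : Ell1 => (‖b‖ + ‖a‖) * ‖b - a‖ := by fun_prop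
    simpa using this.tendsto a
  exact squeeze_zero (fun _ => norm_nonneg _) (fun b => abs_mass_sub_le b a) h

/-- The resonance function vanishes exactly on the lines i = k and i = j. Each line contributes M
a_k, and their common point (k, k) is counted twice, which explains the subtracted term. -/
lemma hasSum_resonant (s : ℝ) (a : Ell1) (k : ℤ) :
    HasSum (fun p => if resonance k p = 0 then interaction s a a a k p else 0)
      (((2 * mass a - ‖a k‖ ^ 2 : ℝ) : ℂ) * a k) := by
  have hm : HasSum (fun j => ((‖a j‖ ^ 2 : ℝ) : ℂ) * a k) ((mass a : ℂ) * a k) :=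
    (Complex.hasSum_ofReal.2 (summable_sq a).hasSum).mul_right _
  have h1 : HasSum (fun p : ℤ × ℤ => if p.1 = k then ((‖a p.2‖ ^ 2 : ℝ) : ℂ) * a k else 0)
      ((mass a : ℂ) * a k) := by
    have hi : Function.Injective fun j : ℤ => (k, j) := fun _ _ h => (Prod.mk.inj h).2
    rw [← hi.hasSum_iff]
    · simpa [Function.comp_def] using hm
    · rintro ⟨x, y⟩ h
      rw [if_neg]
      rintro rfl
      exact h ⟨y, rfl⟩
  have h2 : HasSum (fun p : ℤ × ℤ => if p.1 = p.2 then ((‖a p.1‖ ^ 2 : ℝ) : ℂ) * a k else 0)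
      ((mass a : ℂ) * a k) := by
    have hi : Function.Injective fun j : ℤ => (j, j) := fun _ _ h => (Prod.mk.inj h).2
    rw [← hi.hasSum_iff]
    · simpa [Function.comp_def] using hm
    · rintro ⟨x, y⟩ h
      rw [if_neg]
      intro (hxy : x = y)
      exact h ⟨x, by rw [hxy]⟩
  have h3 := hasSum_ite_eq ((k, k) : ℤ × ℤ) (((‖a k‖ ^ 2 : ℝ) : ℂ) * a k)
  have h := (h1.add h2).sub h3
  have hv : ((2 * mass a - ‖a k‖ ^ 2 : ℝ) : ℂ) * a k
      = (mass a : ℂ) * a k + (mass a : ℂ) * a k - ((‖a k‖ ^ 2 : ℝ) : ℂ) * a k := by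
    push_cast; ring
  rw [hv]
  refine h.congr_fun ?_
  · rintro ⟨i, j⟩
    have hosc : ∀ x : ℤ, x = 0 → osc s x = 1 := by rintro _ rfl; simp [osc]
    have hn : ∀ z : ℂ, z * (starRingEnd ℂ) z = ((‖z‖ ^ 2 : ℝ) : ℂ) := by
      intro z; rw [Complex.mul_conj, Complex.normSq_eq_norm_sq]
    have hr : resonance k (i, j) = 0 ↔ i = k ∨ i = j := by
      simp only [resonance, mul_eq_zero, sub_eq_zero, OfNat.ofNat_ne_zero, false_or]
      tauto
    by_cases hik : i = k
    · subst hik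
      rw [if_pos (hr.2 (Or.inl rfl)), interaction, hosc _ (hr.2 (Or.inl rfl))]
      have hl : i - i + j = j := by ring
      simp only [hl]
      by_cases hij : i = j
      · subst hij; simp [← hn]
      · have : ¬ ((i, j) = (i, i)) := by simpa using fun h => hij h.symm
        simp only [if_true, hij, this, if_false, ← hn]; ring
    · by_cases hij : i = j
      · subst hij
        rw [if_pos (hr.2 (Or.inr rfl)), interaction, hosc _ (hr.2 (Or.inr rfl))]
        have hl : k - i + i = k := by ring
        simp [hik, hl, ← hn]
      · have h1 : ¬ (resonance k (i, j) = 0) := by rw [hr]; tauto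
        simp [hik, hij, h1]

/-- The non-resonant interactions. -/
def nonresonant (s : ℝ) (a : Ell1) (k : ℤ) (p : ℤ × ℤ) : ℂ :=
  if resonance k p = 0 then 0 else interaction s a a a k p

lemma cubic_eq_nonresonant (s : ℝ) (a : Ell1) (k : ℤ) :
    cubic s a a a k = ∑' p, nonresonant s a k p + ((2 * mass a - ‖a k‖ ^ 2 : ℝ) : ℂ) * a k := by
  have h := hasSum_resonant s a k
  have h2 := (summable_interaction s a a a k).hasSum.sub h
  have h3 : HasSum (nonresonant s a k)
      (cubic s a a a k - ((2 * mass a - ‖a k‖ ^ 2 : ℝ) : ℂ) * a k) := by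
    refine h2.congr_fun fun p => ?_
    unfold nonresonant; split_ifs <;> simp
  rw [h3.tsum_eq]; ring

/-! ### Normal form: gauge, integration by parts, amplitudes. -/

lemma hasDerivAt_osc (n : ℤ) (s : ℝ) :
    HasDerivAt (fun s => osc s n) (osc s n * (n * Complex.I)) s := by
  unfold osc
  have h : HasDerivAt (fun s : ℝ => (((s * n : ℝ) : ℂ) * Complex.I)) (n * Complex.I) s := by
    have := ((hasDerivAt_id s).mul_const (n : ℝ)).ofReal_comp.mul_const Complex.I
    simpa using this
  exact h.cexp

/-- Integration by parts against e^{isn}/(in). A nonzero integer n has |1/n| ≤ 1, so the bound is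
uniform in n, and the boundary terms carry no factor T. -/
lemma enorm_integral_osc_le {B B' : ℝ → ℂ} {T : ℝ} (hT : 0 ≤ T) (hB : Continuous B)
    (hB' : Continuous B') (hd : ∀ s ∈ Ioo 0 T, HasDerivAt B (B' s) s) {n : ℤ} (hn : n ≠ 0) :
    ‖∫ s in Ioc 0 T, osc s n * B s‖ₑ
      ≤ ‖B T‖ₑ + ‖B 0‖ₑ + ∫⁻ s in Ioc 0 T, ‖B' s‖ₑ := by
  have hn' : (n : ℂ) * Complex.I ≠ 0 := by simp [hn]
  set w : ℂ := ((n : ℂ) * Complex.I)⁻¹ with hw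
  have hw1 : ‖w‖ ≤ 1 := by
    rw [hw, norm_inv, norm_mul, Complex.norm_I, mul_one]
    refine inv_le_one_of_one_le₀ ?_
    rw [Complex.norm_intCast]
    exact_mod_cast Int.one_le_abs hn
  have hwe : ‖w‖ₑ ≤ 1 := by
    rw [← ofReal_norm, ENNReal.ofReal_le_one]; exact hw1
  have hftc := intervalIntegral.integral_eq_sub_of_hasDerivAt_of_le
    (f := fun s => osc s n * B s * w)
    (f' := fun s => osc s n * B s + osc s n * B' s * w) hT (by fun_prop) (fun s hs => by
      have := ((hasDerivAt_osc n s).mul (hd s hs)).mul_const w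
      refine this.congr_deriv ?_
      have : (n : ℂ) * Complex.I * w = 1 := mul_inv_cancel₀ hn'
      linear_combination (osc s n * B s) * this) (by
      apply Continuous.intervalIntegrable; fun_prop)
  rw [intervalIntegral.integral_add (by apply Continuous.intervalIntegrable; fun_prop)
    (by apply Continuous.intervalIntegrable; fun_prop)] at hftc
  rw [← intervalIntegral.integral_of_le hT]
  have e : ∫ s in (0 : ℝ)..T, osc s n * B s = osc T n * B T * w
      - (osc 0 n * B 0 * w) - ∫ s in (0 : ℝ)..T, osc s n * B' s * w := by
    linear_combination hftc
  rw [e, intervalIntegral.integral_of_le hT]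
  refine (enorm_sub_le).trans (add_le_add ((enorm_sub_le).trans (add_le_add ?_ ?_)) ?_)
  · simpa using mul_le_of_le_one_right' hwe
  · simpa using mul_le_of_le_one_right' hwe
  · refine (enorm_integral_le_lintegral_enorm _).trans (lintegral_mono fun s => ?_)
    simpa using mul_le_of_le_one_right' hwe

/-- The phase `θₖ(t) = κ ∫₀ᵗ (2 M - |aₖ|²)` produced by the resonant interactions. -/
def resPhase (κ : ℝ) (a : ℝ → Ell1) (k : ℤ) (t : ℝ) : ℝ :=
  ∫ s in (0 : ℝ)..t, κ * (2 * mass (a s) - ‖a s k‖ ^ 2)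

/-- The unimodular factor that removes the resonant interactions. -/
def gauge (κ : ℝ) (a : ℝ → Ell1) (k : ℤ) (t : ℝ) : ℂ :=
  Complex.exp ((resPhase κ a k t : ℂ) * Complex.I)

@[simp] lemma norm_gauge (κ : ℝ) (a : ℝ → Ell1) (k : ℤ) (t : ℝ) : ‖gauge κ a k t‖ = 1 :=
  Complex.norm_exp_ofReal_mul_I _

@[simp] lemma enorm_gauge (κ : ℝ) (a : ℝ → Ell1) (k : ℤ) (t : ℝ) : ‖gauge κ a k t‖ₑ = 1 := by
  rw [← ofReal_norm]; simp

@[simp] lemma gauge_zero (κ : ℝ) (a : ℝ → Ell1) (k : ℤ) : gauge κ a k 0 = 1 := by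
  simp [gauge, resPhase]

lemma hasDerivAt_gauge (κ : ℝ) {a : ℝ → Ell1} (ha : Continuous a) (k : ℤ) (t : ℝ) :
    HasDerivAt (gauge κ a k)
      (gauge κ a k t * ((κ * (2 * mass (a t) - ‖a t k‖ ^ 2) : ℝ) * Complex.I)) t := by
  have hc : Continuous fun s => κ * (2 * mass (a s) - ‖a s k‖ ^ 2) := by
    have h1 := continuous_mass.comp ha
    have h2 := (continuous_coord k).comp ha
    simp only [Function.comp_def] at h1 h2
    fun_prop
  have h : HasDerivAt (resPhase κ a k) (κ * (2 * mass (a t) - ‖a t k‖ ^ 2)) t :=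
    hc.deriv_integral _ 0 t ▸ (intervalIntegral.integral_hasDerivAt_right
      (hc.intervalIntegrable _ _) (hc.stronglyMeasurableAtFilter _ _) hc.continuousAt
      |>.differentiableAt.hasDerivAt)
  exact (h.ofReal_comp.mul_const Complex.I).cexp

/-- `a` solves the equation in the interaction picture on `(0, T)`, coordinate by coordinate. -/
structure IsInteractionSolution (κ T : ℝ) (a : ℝ → Ell1) : Prop where
  continuous : Continuous a
  hasDerivAt : ∀ t ∈ Ioo 0 T, ∀ k, HasDerivAt (fun s => a s k) (field κ t (a t) k) t

lemma continuous_field (κ : ℝ) {a : ℝ → Ell1} (ha : Continuous a) :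
    Continuous fun s => field κ s (a s) := by
  unfold field
  exact (continuous_cubicEll1.comp (continuous_id.prodMk ha)).const_smul
    (-(Complex.I * (κ : ℂ)))

lemma field_apply (κ s : ℝ) (a : Ell1) (k : ℤ) :
    field κ s a k = -(Complex.I * κ) * cubic s a a a k := by
  simp only [field, lp.coeFn_smul, Pi.smul_apply, cubicEll1_apply, smul_eq_mul]

lemma norm_field_le {κ : ℝ} (hκ : 0 ≤ κ) (s : ℝ) {a : Ell1} {R : ℝ} (h : ‖a‖ ≤ R) :
    ‖field κ s a‖ ≤ κ * R ^ 3 := by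
  have hR : 0 ≤ R := (norm_nonneg a).trans h
  rw [field, norm_smul]
  simp only [norm_neg, norm_mul, Complex.norm_I, one_mul, Complex.norm_real,
    Real.norm_of_nonneg hκ]
  refine mul_le_mul_of_nonneg_left ((norm_cubicEll1_le s a a a).trans ?_) hκ
  calc _ ≤ R * R * R := by gcongr
    _ = R ^ 3 := by ring

/-- The slowly varying amplitude of an interaction. -/
def amplitude (κ : ℝ) (a : ℝ → Ell1) (k : ℤ) (p : ℤ × ℤ) (s : ℝ) : ℂ :=
  gauge κ a k s * (a s p.1 * (starRingEnd ℂ) (a s p.2) * a s (k - p.1 + p.2))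

/-- The time derivative of the amplitude of an interaction along a solution. -/
def amplitudeDeriv (κ : ℝ) (a : ℝ → Ell1) (k : ℤ) (p : ℤ × ℤ) (s : ℝ) : ℂ :=
  gauge κ a k s * ((κ * (2 * mass (a s) - ‖a s k‖ ^ 2) : ℝ) * Complex.I) *
      (a s p.1 * (starRingEnd ℂ) (a s p.2) * a s (k - p.1 + p.2)) +
    gauge κ a k s *
      ((field κ s (a s) p.1 * (starRingEnd ℂ) (a s p.2) +
        a s p.1 * (starRingEnd ℂ) (field κ s (a s) p.2)) * a s (k - p.1 + p.2) +
      a s p.1 * (starRingEnd ℂ) (a s p.2) * field κ s (a s) (k - p.1 + p.2))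

lemma continuous_gauge (κ : ℝ) {a : ℝ → Ell1} (ha : Continuous a) (k : ℤ) :
    Continuous (gauge κ a k) :=
  continuous_iff_continuousAt.2 fun t => (hasDerivAt_gauge κ ha k t).continuousAt

lemma continuous_amplitude (κ : ℝ) {a : ℝ → Ell1} (ha : Continuous a) (k : ℤ) (p : ℤ × ℤ) :
    Continuous (amplitude κ a k p) := by
  have h1 := continuous_gauge κ ha k
  have h2 := fun k => (continuous_coord k).comp ha
  simp only [Function.comp_def] at h2
  unfold amplitude
  exact h1.mul (((h2 _).mul (Complex.continuous_conj.comp (h2 _))).mul (h2 _))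

lemma continuous_amplitudeDeriv (κ : ℝ) {a : ℝ → Ell1} (ha : Continuous a) (k : ℤ)
    (p : ℤ × ℤ) : Continuous (amplitudeDeriv κ a k p) := by
  have h1 := continuous_gauge κ ha k
  have h2 := fun k => (continuous_coord k).comp ha
  have h3 := fun k => (continuous_coord k).comp (continuous_field κ ha)
  have h4 := continuous_mass.comp ha
  simp only [Function.comp_def] at h2 h3 h4
  have h5 := fun k => Complex.continuous_conj.comp (h2 k)
  have h6 := fun k => Complex.continuous_conj.comp (h3 k)
  simp only [Function.comp_def] at h5 h6
  have h7 : Continuous fun s => ((κ * (2 * mass (a s) - ‖a s k‖ ^ 2) : ℝ) : ℂ) :=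
    Complex.continuous_ofReal.comp
      (continuous_const.mul ((continuous_const.mul h4).sub ((h2 k).norm.pow 2)))
  unfold amplitudeDeriv
  exact ((h1.mul (h7.mul continuous_const)).mul (((h2 _).mul (h5 _)).mul (h2 _))).add
    (h1.mul (((((h3 _).mul (h5 _)).add ((h2 _).mul (h6 _))).mul (h2 _)).add
      (((h2 _).mul (h5 _)).mul (h3 _))))

lemma hasDerivAt_amplitude {κ T : ℝ} {a : ℝ → Ell1} (h : IsInteractionSolution κ T a) (k : ℤ)
    (p : ℤ × ℤ) {s : ℝ} (hs : s ∈ Ioo 0 T) :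
    HasDerivAt (amplitude κ a k p) (amplitudeDeriv κ a k p s) s := by
  have h1 := h.hasDerivAt s hs
  exact (hasDerivAt_gauge κ h.continuous k s).mul
    (((h1 p.1).mul (h1 p.2).star).mul (h1 (k - p.1 + p.2)))

lemma tsum_enorm_amplitude (κ : ℝ) (a : ℝ → Ell1) (s : ℝ) :
    ∑' k, ∑' p, ‖amplitude κ a k p s‖ₑ = ‖a s‖ₑ * ‖a s‖ₑ * ‖a s‖ₑ := by
  rw [← tsum_tsum_enorm_interaction 0]
  simp [amplitude, enorm_interaction]

lemma enorm_le_ofReal {E : Type*} [SeminormedAddCommGroup E] {x : E} {C : ℝ} (h : ‖x‖ ≤ C) :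
    ‖x‖ₑ ≤ ENNReal.ofReal C := by
  rw [← ofReal_norm]; exact ENNReal.ofReal_le_ofReal h

/-- Of the constant 6, three units come from the derivative of the gauge, through |2M - |a_k|²| ≤
3R², and one from each of the three factors, whose derivatives have ℓ¹ norm at most κR³. -/
lemma tsum_enorm_amplitudeDeriv_le {κ R : ℝ} (hκ : 0 ≤ κ) {a : ℝ → Ell1} {s : ℝ}
    (hR : ‖a s‖ ≤ R) :
    ∑' k, ∑' p, ‖amplitudeDeriv κ a k p s‖ₑ ≤ ENNReal.ofReal (6 * κ * R ^ 5) := by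
  have hR0 : 0 ≤ R := (norm_nonneg _).trans hR
  set A : ℤ → ℝ≥0∞ := fun k => ‖a s k‖ₑ
  set D : ℤ → ℝ≥0∞ := fun k => ‖field κ s (a s) k‖ₑ
  have hA : ∑' k, A k ≤ ENNReal.ofReal R := by
    simp only [A, tsum_enorm_eq]; exact enorm_le_ofReal hR
  have hD : ∑' k, D k ≤ ENNReal.ofReal (κ * R ^ 3) := by
    simp only [D, tsum_enorm_eq]; exact enorm_le_ofReal (norm_field_le hκ s hR)
  have hpt : ∀ k (p : ℤ × ℤ), ‖amplitudeDeriv κ a k p s‖ₑ ≤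
      ENNReal.ofReal (3 * κ * R ^ 2) * (A p.1 * A p.2 * A (k - p.1 + p.2)) +
      (D p.1 * A p.2 * A (k - p.1 + p.2) + A p.1 * D p.2 * A (k - p.1 + p.2)
        + A p.1 * A p.2 * D (k - p.1 + p.2)) := by
    intro k p
    have hc : ‖((κ * (2 * mass (a s) - ‖a s k‖ ^ 2) : ℝ) : ℂ) * Complex.I‖ ≤ 3 * κ * R ^ 2 := by
      rw [norm_mul, Complex.norm_I, mul_one, Complex.norm_real, Real.norm_eq_abs, abs_mul,
        abs_of_nonneg hκ]
      have h1 := mass_le (a s)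
      have h2 := mass_nonneg (a s)
      have h3 : ‖a s k‖ ^ 2 ≤ R ^ 2 := by
        have := (norm_coord_le (a s) k).trans hR
        gcongr
      have h4 : ‖a s‖ ^ 2 ≤ R ^ 2 := by gcongr
      have : |2 * mass (a s) - ‖a s k‖ ^ 2| ≤ 3 * R ^ 2 := by
        rw [abs_le]; constructor <;> nlinarith [sq_nonneg ‖a s k‖]
      nlinarith
    have hc' := enorm_le_ofReal hc
    unfold amplitudeDeriv
    refine (enorm_add_le _ _).trans (add_le_add ?_ ?_)
    · rw [enorm_mul, enorm_mul, enorm_gauge, one_mul]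
      refine mul_le_mul' hc' ?_
      simp [A, enorm_mul]
    · rw [enorm_mul, enorm_gauge, one_mul, add_mul]
      refine (enorm_add_le _ _).trans (add_le_add ((enorm_add_le _ _).trans_eq ?_) (le_of_eq ?_))
      · simp [A, D, enorm_mul]
      · simp [A, D, enorm_mul]
  refine (ENNReal.tsum_le_tsum fun k => ENNReal.tsum_le_tsum (hpt k)).trans ?_
  simp_rw [ENNReal.tsum_add, ENNReal.tsum_mul_left, tsum_tsum_conv]
  set S := ∑' k, A k
  set S' := ∑' k, D k
  calc _ ≤ ENNReal.ofReal (3 * κ * R ^ 2) * (ENNReal.ofReal R * ENNReal.ofReal R * ENNReal.ofReal R)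
        + (ENNReal.ofReal (κ * R ^ 3) * ENNReal.ofReal R * ENNReal.ofReal R
          + ENNReal.ofReal R * ENNReal.ofReal (κ * R ^ 3) * ENNReal.ofReal R
          + ENNReal.ofReal R * ENNReal.ofReal R * ENNReal.ofReal (κ * R ^ 3)) := by gcongr
    _ = ENNReal.ofReal (6 * κ * R ^ 5) := by
      rw [← ENNReal.ofReal_mul, ← ENNReal.ofReal_mul, ← ENNReal.ofReal_mul, ← ENNReal.ofReal_mul,
        ← ENNReal.ofReal_mul, ← ENNReal.ofReal_mul, ← ENNReal.ofReal_mul, ← ENNReal.ofReal_mul,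
        ← ENNReal.ofReal_add, ← ENNReal.ofReal_add, ← ENNReal.ofReal_add]
      · congr 1; ring
      all_goals positivity

/-- The derivative of the gauge cancels the resonant part of the cubic term exactly. -/
lemma hasDerivAt_gauge_mul {κ T : ℝ} {a : ℝ → Ell1} (h : IsInteractionSolution κ T a) (k : ℤ)
    {s : ℝ} (hs : s ∈ Ioo 0 T) :
    HasDerivAt (fun s => gauge κ a k s * a s k)
      (gauge κ a k s * (-(Complex.I * κ) * ∑' p, nonresonant s (a s) k p)) s := by
  have := (hasDerivAt_gauge κ h.continuous k s).mul (h.hasDerivAt s hs k)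
  refine this.congr_deriv ?_
  rw [field_apply, cubic_eq_nonresonant]
  push_cast
  ring

/-- Normal form estimate: after removal of the resonant phases the Fourier coefficients of a
solution are almost constant. -/
theorem tsum_enorm_gauge_mul_sub_le {κ T R : ℝ} (hκ : 0 ≤ κ) (hT : 0 ≤ T) {a : ℝ → Ell1}
    (h : IsInteractionSolution κ T a) (hR : ∀ t ∈ Icc 0 T, ‖a t‖ ≤ R) :
    ∑' k, ‖gauge κ a k T * a T k - a 0 k‖ₑ
      ≤ ENNReal.ofReal (κ * (2 * R ^ 3 + 6 * κ * R ^ 5 * T)) := by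
  have hR0 : 0 ≤ R := (norm_nonneg _).trans (hR 0 ⟨le_rfl, hT⟩)
  have ha := h.continuous
  have hcoord := fun k => (continuous_coord k).comp ha
  simp only [Function.comp_def] at hcoord
  -- a single coefficient
  have hk : ∀ k, ‖gauge κ a k T * a T k - a 0 k‖ₑ ≤ ENNReal.ofReal κ *
      ∑' p, (‖amplitude κ a k p T‖ₑ + ‖amplitude κ a k p 0‖ₑ
        + ∫⁻ s in Ioc 0 T, ‖amplitudeDeriv κ a k p s‖ₑ) := by
    intro k
    have hderiv : ∀ s, gauge κ a k s * (-(Complex.I * κ) * ∑' p, nonresonant s (a s) k p)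
        = -(Complex.I * κ) * (gauge κ a k s * (cubic s (a s) (a s) (a s) k
          - ((2 * mass (a s) - ‖a s k‖ ^ 2 : ℝ) : ℂ) * a s k)) := by
      intro s; rw [cubic_eq_nonresonant]; ring
    have hcont : Continuous fun s =>
        gauge κ a k s * (-(Complex.I * κ) * ∑' p, nonresonant s (a s) k p) := by
      simp_rw [hderiv]
      have h1 := continuous_gauge κ ha k
      have h2 : Continuous fun s => cubic s (a s) (a s) (a s) k :=
        (continuous_coord k).comp (continuous_cubicEll1.comp (continuous_id.prodMk ha))
      have h3 : Continuous fun s => ((2 * mass (a s) - ‖a s k‖ ^ 2 : ℝ) : ℂ) :=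
        Complex.continuous_ofReal.comp
          ((continuous_const.mul (continuous_mass.comp ha)).sub ((hcoord k).norm.pow 2))
      exact continuous_const.mul (h1.mul (h2.sub (h3.mul (hcoord k))))
    have hftc := intervalIntegral.integral_eq_sub_of_hasDerivAt_of_le hT
      ((continuous_gauge κ ha k).mul (hcoord k)).continuousOn
      (fun s hs => hasDerivAt_gauge_mul h k hs) (hcont.intervalIntegrable _ _)
    simp only [Pi.mul_apply, gauge_zero, one_mul] at hftc
    rw [← hftc, intervalIntegral.integral_of_le hT]
    -- exchange of sum and integral
    set f : ℤ × ℤ → ℝ → ℂ := fun p s =>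
      if resonance k p = 0 then 0 else osc s (resonance k p) * amplitude κ a k p s with hf
    have hfeq : ∀ s, gauge κ a k s * (-(Complex.I * κ) * ∑' p, nonresonant s (a s) k p)
        = -(Complex.I * κ) * ∑' p, f p s := by
      intro s
      rw [mul_left_comm, ← tsum_mul_left]
      congr 2; ext p
      simp only [nonresonant, hf, interaction, amplitude]
      split_ifs
      · simp
      · ring
    have hfc : ∀ p, Continuous (f p) := by
      intro p
      have := continuous_amplitude κ ha k p
      simp only [hf]
      split_ifs <;> fun_prop
    have hfle : ∀ p s, ‖f p s‖ₑ ≤ ‖amplitude κ a k p s‖ₑ := by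
      intro p s; simp only [hf]; split_ifs <;> simp
    simp_rw [hfeq]
    rw [integral_const_mul, integral_tsum]
    · rw [enorm_mul]
      refine mul_le_mul' (by simp [← ofReal_norm, abs_of_nonneg hκ]) ?_
      refine (enorm_tsum_le _).trans (ENNReal.tsum_le_tsum fun p => ?_)
      by_cases hp : resonance k p = 0
      · simp [hf, hp]
      · simp only [hf, hp, if_false]
        exact enorm_integral_osc_le hT (continuous_amplitude κ ha k p)
          (continuous_amplitudeDeriv κ ha k p) (fun s hs => hasDerivAt_amplitude h k p hs) hp
    · exact fun p => (hfc p).aestronglyMeasurable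
    -- Sum and integral may be exchanged because the absolute sum over p is at most R³ at every time
    -- of (0, T].
    · rw [← lintegral_tsum fun p => (hfc p).enorm.measurable.aemeasurable]
      refine ne_top_of_le_ne_top ?_ (setLIntegral_mono
        (g := fun _ => ENNReal.ofReal R * ENNReal.ofReal R * ENNReal.ofReal R)
        measurable_const fun s hs => ?_)
      · simp [ENNReal.mul_eq_top]
      · refine (ENNReal.tsum_le_tsum fun p => hfle p s).trans 
          ((ENNReal.le_tsum (f := fun k => ∑' p, ‖amplitude κ a k p s‖ₑ) k).trans ?_)
        rw [tsum_enorm_amplitude]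
        have := enorm_le_ofReal (hR s ⟨hs.1.le, hs.2⟩)
        gcongr
  -- Summed over k, the two boundary terms give 2R³ and the integrated derivative gives 6κR⁵T. Only
  -- the latter grows with T, and it carries an additional factor κ.
  refine (ENNReal.tsum_le_tsum hk).trans ?_
  rw [ENNReal.tsum_mul_left]
  simp_rw [ENNReal.tsum_add]
  rw [tsum_enorm_amplitude, tsum_enorm_amplitude]
  have hm : ∀ k p, Measurable fun s => ‖amplitudeDeriv κ a k p s‖ₑ := fun k p =>
    (continuous_amplitudeDeriv κ ha k p).enorm.measurable
  have hI : ∑' k, ∑' p, ∫⁻ s in Ioc 0 T, ‖amplitudeDeriv κ a k p s‖ₑ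
      ≤ ENNReal.ofReal (6 * κ * R ^ 5) * ENNReal.ofReal T := by
    simp_rw [← lintegral_tsum fun p => (hm _ p).aemeasurable]
    rw [← lintegral_tsum fun k => (Measurable.tsum (hm k)).aemeasurable]
    refine (setLIntegral_mono (g := fun _ => ENNReal.ofReal (6 * κ * R ^ 5))
      measurable_const fun s hs => ?_).trans_eq ?_
    · exact tsum_enorm_amplitudeDeriv_le hκ (hR s ⟨hs.1.le, hs.2⟩)
    · simp
  have hb : ∀ t ∈ Icc 0 T, ‖a t‖ₑ * ‖a t‖ₑ * ‖a t‖ₑ ≤ ENNReal.ofReal (R ^ 3) := by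
    intro t ht
    have := enorm_le_ofReal (hR t ht)
    rw [pow_succ, sq, ENNReal.ofReal_mul (by positivity), ENNReal.ofReal_mul (by positivity)]
    gcongr
  calc _ ≤ ENNReal.ofReal κ * (ENNReal.ofReal (R ^ 3) + ENNReal.ofReal (R ^ 3)
        + ENNReal.ofReal (6 * κ * R ^ 5) * ENNReal.ofReal T) := by
        gcongr
        · exact hb T ⟨hT, le_rfl⟩
        · exact hb 0 ⟨le_rfl, hT⟩
    _ = _ := by
      rw [← ENNReal.ofReal_mul (by positivity), ← ENNReal.ofReal_add (by positivity)
        (by positivity), ← ENNReal.ofReal_add (by positivity) (by positivity),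
        ← ENNReal.ofReal_mul hκ]
      congr 1; ring

lemma norm_le_add_of_gauge {κ r η t : ℝ} {a : ℝ → Ell1} (hη : 0 ≤ η) (h0 : ‖a 0‖ ≤ r)
    (h : ∑' k, ‖gauge κ a k t * a t k - a 0 k‖ₑ ≤ ENNReal.ofReal η) : ‖a t‖ ≤ r + η := by
  have hr : 0 ≤ r := (norm_nonneg _).trans h0
  rw [enorm_le_iff_tsum_enorm_le _ (by positivity), ENNReal.ofReal_add hr hη]
  calc ∑' k, ‖a t k‖ₑ ≤ ∑' k, (‖a 0 k‖ₑ + ‖gauge κ a k t * a t k - a 0 k‖ₑ) := by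
        refine ENNReal.tsum_le_tsum fun k => ?_
        have : ‖a t k‖ₑ = ‖a 0 k + (gauge κ a k t * a t k - a 0 k)‖ₑ := by
          rw [add_sub_cancel, enorm_mul, enorm_gauge, one_mul]
        rw [this]; exact enorm_add_le _ _
    _ ≤ _ := by
      rw [ENNReal.tsum_add]
      exact add_le_add ((enorm_le_iff_tsum_enorm_le _ hr).1 h0) h

/-! ### Bootstrap. -/

/-- Bootstrap: under a smallness condition the norm of a solution at most doubles. It suffices that
the equation holds as long as the norm stays below `2 r`. -/
theorem norm_le_of_bootstrap {κ T r η : ℝ} (hκ : 0 ≤ κ) {a : ℝ → Ell1}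
    (ha : Continuous a)
    (hsol : ∀ T' ∈ Icc 0 T, (∀ t ∈ Icc 0 T', ‖a t‖ ≤ 2 * r) → IsInteractionSolution κ T' a)
    (h0 : ‖a 0‖ ≤ r) (hη : η < r)
    (hsmall : κ * (2 * (2 * r) ^ 3 + 6 * κ * (2 * r) ^ 5 * T) ≤ η) :
    ∀ t ∈ Icc 0 T, ‖a t‖ ≤ 2 * r := by
  have hr : 0 ≤ r := (norm_nonneg _).trans h0
  have key : ∀ T' ∈ Icc 0 T, (∀ t ∈ Icc 0 T', ‖a t‖ ≤ 2 * r) → ‖a T'‖ ≤ r + η := by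
    intro T' hT' hb
    have h := tsum_enorm_gauge_mul_sub_le hκ hT'.1 (hsol T' hT' hb) hb
    have hη0 : 0 ≤ η := le_trans (by have := hT'.1.trans hT'.2; positivity) hsmall
    have h2 : κ * (2 * (2 * r) ^ 3 + 6 * κ * (2 * r) ^ 5 * T') ≤ η := by
      refine le_trans ?_ hsmall
      have := hT'.2
      gcongr
    exact norm_le_add_of_gauge hη0 h0 (h.trans (ENNReal.ofReal_le_ofReal h2))
  by_contra! hcon
  obtain ⟨t₁, ht₁, hlt⟩ := hcon
  set S : Set ℝ := {t ∈ Icc 0 T | 2 * r ≤ ‖a t‖} with hS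
  have hScl : IsCompact S := by
    refine isCompact_Icc.inter_right ?_
    exact isClosed_le continuous_const ha.norm
  -- τ is the first time at which the norm reaches 2r. By the intermediate value theorem and
  -- minimality the norm equals 2r there, so the a priori bound holds on all of [0, τ] and `key`
  -- improves it at τ to r + η < 2r.
  obtain ⟨τ, hτ, hmin⟩ := hScl.exists_isLeast ⟨t₁, ht₁, hlt.le⟩
  obtain ⟨t', ht', he⟩ := intermediate_value_Icc hτ.1.1 ha.norm.continuousOn
    (show 2 * r ∈ Icc ‖a 0‖ ‖a τ‖ from ⟨by linarith, hτ.2⟩)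
  have ht'S : t' ∈ S := ⟨⟨ht'.1, ht'.2.trans hτ.1.2⟩, he.ge⟩
  have hle : ∀ t ∈ Icc 0 τ, ‖a t‖ ≤ 2 * r := by
    intro t ht
    rcases eq_or_lt_of_le ht.2 with rfl | hlt
    · have : t' = t := le_antisymm ht'.2 (hmin ht'S)
      rw [← this]; exact he.le
    · by_contra! hc
      exact absurd (hmin (show t ∈ S from ⟨⟨ht.1, ht.2.trans hτ.1.2⟩, hc.le⟩)) (not_le.2 hlt)
  have := key τ hτ.1 hle
  linarith [hτ.2]


/-! ### Free evolution and Fourier series on the torus. -/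

lemma osc_add (s : ℝ) (m n : ℤ) : osc s (m + n) = osc s m * osc s n := by
  simp only [osc, ← Complex.exp_add]; congr 1; push_cast; ring

@[simp] lemma osc_zero_right (s : ℝ) : osc s 0 = 1 := by simp [osc]

@[simp] lemma osc_zero_left (n : ℤ) : osc 0 n = 1 := by simp [osc]

lemma osc_neg_left (s : ℝ) (n : ℤ) : osc (-s) n = osc s (-n) := by simp [osc]

lemma osc_neg_mul (s : ℝ) (n : ℤ) : osc s (-n) * osc s n = 1 := by rw [← osc_add]; simp

lemma conj_osc (s : ℝ) (n : ℤ) : (starRingEnd ℂ) (osc s n) = osc s (-n) := by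
  simp only [osc, ← Complex.exp_conj]; congr 1; simp

/-- The Fourier coefficients of a function, as an element of `ℓ¹` (zero if not summable). -/
def toEll1 (f : ℤ → ℂ) : Ell1 :=
  if h : ∑' k, ‖f k‖ₑ ≠ ∞ then ⟨f, memℓp_one_of_tsum_enorm h⟩ else 0

lemma toEll1_apply {f : ℤ → ℂ} (h : ∑' k, ‖f k‖ₑ ≠ ∞) (k : ℤ) : toEll1 f k = f k := by
  simp [toEll1, h]

/-- The free Schrödinger evolution on Fourier coefficients. -/
def freeEvol (s : ℝ) (a : Ell1) : Ell1 :=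
  ⟨fun k => osc s (-k ^ 2) * a k, memℓp_one_of_tsum_enorm (by
    simp [enorm_mul, tsum_enorm_eq])⟩

@[simp] lemma freeEvol_apply (s : ℝ) (a : Ell1) (k : ℤ) :
    freeEvol s a k = osc s (-k ^ 2) * a k := rfl

lemma freeEvol_sub (s : ℝ) (a b : Ell1) : freeEvol s (a - b) = freeEvol s a - freeEvol s b := by
  ext k; simp [mul_sub]

@[simp] lemma norm_freeEvol (s : ℝ) (a : Ell1) : ‖freeEvol s a‖ = ‖a‖ := by
  simp [norm_eq_tsum]

/-- Each time map is an isometry and each orbit is continuous by dominated convergence; together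
these give joint continuity. -/
lemma continuous_freeEvol : Continuous fun q : ℝ × Ell1 => freeEvol q.1 q.2 := by
  refine continuous_prod_of_continuous_lipschitzWith' (fun q : ℝ × Ell1 => freeEvol q.1 q.2) 1
    (fun s => ?_) fun a => ?_
  · refine LipschitzWith.of_dist_le_mul fun x y => ?_
    rw [dist_eq_norm, dist_eq_norm]
    simp [← freeEvol_sub]
  · rw [continuous_iff_continuousAt]
    intro t
    rw [ContinuousAt, tendsto_iff_norm_sub_tendsto_zero]
    simp_rw [norm_eq_tsum]
    have hz : (0 : ℝ) = ∑' k : ℤ, (0 : ℝ) := by simp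
    rw [hz]
    refine tendsto_tsum_of_dominated_convergence ((summable_norm_ell1 a).mul_left 2) ?_ ?_
    · intro k
      have h : Continuous fun s => ‖osc s (-k ^ 2) * a k - osc t (-k ^ 2) * a k‖ := by fun_prop
      simpa using h.tendsto t
    · filter_upwards with s k
      simp only [lp.coeFn_sub, Pi.sub_apply, freeEvol_apply, norm_norm]
      refine (norm_sub_le _ _).trans ?_
      simp [two_mul]

lemma norm_fourier_apply (n : ℤ) (x : Torus) : ‖fourier n x‖ = 1 := by
  rw [fourier_apply]; exact Circle.norm_coe _

lemma fourierCoeff_tsum {ι : Type*} [Countable ι] (h : ι → C(Torus, ℂ)) (hs : ∑' i, ‖h i‖ₑ ≠ ∞)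
    (n : ℤ) : fourierCoeff (fun x => ∑' i, h i x) n = ∑' i, fourierCoeff (h i) n := by
  unfold fourierCoeff
  rw [← integral_tsum]
  · congr 1; ext x; rw [smul_eq_mul, ← tsum_mul_left]; rfl
  · intro i
    exact (Continuous.aestronglyMeasurable (by fun_prop))
  · refine ne_top_of_le_ne_top hs (ENNReal.tsum_le_tsum fun i => ?_)
    refine (lintegral_mono (g := fun _ => ‖h i‖ₑ) fun x => ?_).trans_eq (by simp)
    rw [smul_eq_mul, enorm_mul, ← ofReal_norm, ← ofReal_norm, ← ofReal_norm,
      ← ENNReal.ofReal_mul (norm_nonneg _)]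
    refine ENNReal.ofReal_le_ofReal ?_
    have h1 : ‖fourier (T := 2 * Real.pi) (-n) x‖ = 1 := norm_fourier_apply _ x
    rw [h1, one_mul]
    exact (h i).norm_coe_le_norm x

lemma fourierCoeff_fourier_mul (m n : ℤ) (c : ℂ) (f : Torus → ℂ) :
    fourierCoeff (fun x : Torus => c * (fourier m x * f x)) n = c * fourierCoeff f (n - m) := by
  rw [fourierCoeff.const_mul]
  congr 1
  unfold fourierCoeff
  congr 1; ext x
  have : -(n - m) = -n + m := by ring
  rw [smul_eq_mul, smul_eq_mul, this, fourier_add, mul_assoc]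

lemma fourierCoeff_sub (f g : C(Torus, ℂ)) (n : ℤ) :
    fourierCoeff (fun x => f x - g x) n = fourierCoeff f n - fourierCoeff g n := by
  unfold fourierCoeff
  have hi : ∀ h : C(Torus, ℂ), Integrable (fun x => fourier (-n) x • h x)
      (AddCircle.haarAddCircle (T := 2 * Real.pi)) := fun h =>
    Continuous.integrable_of_hasCompactSupport (by fun_prop)
      (HasCompactSupport.of_compactSpace _)
  rw [← integral_sub (hi f) (hi g)]
  simp [mul_sub]

lemma summable_fourierCoeff {f : Torus → ℂ} (h : flNorm f < ∞) : Summable (fourierCoeff f) :=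
  (summable_norm_of_tsum_enorm h.ne).of_norm

/-- The Fourier coefficients of `|f|² f`. -/
lemma fourierCoeff_cubic (f : C(Torus, ℂ)) (h : flNorm f < ∞) (n : ℤ) :
    fourierCoeff (fun x => (‖f x‖ : ℂ) ^ 2 * f x) n
      = ∑' p : ℤ × ℤ, fourierCoeff f p.1 * (starRingEnd ℂ) (fourierCoeff f p.2)
          * fourierCoeff f (n - p.1 + p.2) := by
  set F : ℤ → ℂ := fourierCoeff f with hF
  -- Only |f|² is expanded, as a double series, while the last factor f is kept whole.
  -- Multiplication by a character shifts its coefficients, so no triple sum is needed.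
  set H : ℤ × ℤ → C(Torus, ℂ) := fun p =>
    (F p.1 * (starRingEnd ℂ) (F p.2)) • (fourier (p.1 - p.2) * f) with hH
  have hsn : Summable fun k => ‖F k‖ := (summable_fourierCoeff h).norm
  have hpt : ∀ x, ∑' p, H p x = (‖f x‖ : ℂ) ^ 2 * f x := by
    intro x
    have h1 := has_pointwise_sum_fourier_series_of_summable (summable_fourierCoeff h) x
    have h2 : HasSum (fun i => (starRingEnd ℂ) (fourierCoeff f i • fourier i x))
      ((starRingEnd ℂ) (f x)) := h1.map (starRingEnd ℂ) Complex.continuous_conj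
    have hs : Summable fun p : ℤ × ℤ => (fourierCoeff f p.1 • fourier p.1 x) *
        (starRingEnd ℂ) (fourierCoeff f p.2 • fourier p.2 x) := by
      refine summable_mul_of_summable_norm (f := fun i => fourierCoeff f i • fourier i x)
        (g := fun i => (starRingEnd ℂ) (fourierCoeff f i • fourier i x)) ?_ ?_
      · simpa only [norm_smul, norm_fourier_apply, mul_one] using hsn
      · simpa only [norm_smul, RCLike.norm_conj, norm_fourier_apply, mul_one] using hsn
    have h3 := (h1.mul h2 hs).mul_right (f x)
    have h4 : f x * (starRingEnd ℂ) (f x) = (‖f x‖ : ℂ) ^ 2 := by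
      rw [Complex.mul_conj, Complex.normSq_eq_norm_sq]; push_cast; rfl
    rw [h4] at h3
    rw [← h3.tsum_eq]
    congr 1; ext p
    simp only [hH, hF, ContinuousMap.smul_apply, ContinuousMap.mul_apply, smul_eq_mul, map_mul,
      sub_eq_add_neg, fourier_add, fourier_neg]
    ring
  have hfin : ∑' p, ‖H p‖ₑ ≠ ∞ := by
    have hle : ∀ p, ‖H p‖ₑ ≤ ‖F p.1‖ₑ * ‖F p.2‖ₑ * ‖f‖ₑ := by
      intro p
      rw [← ofReal_norm, ← ofReal_norm, ← ofReal_norm, ← ofReal_norm,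
        ← ENNReal.ofReal_mul (norm_nonneg _), ← ENNReal.ofReal_mul (by positivity)]
      refine ENNReal.ofReal_le_ofReal ?_
      simp only [hH, norm_smul, norm_mul, RCLike.norm_conj]
      gcongr
      refine (norm_mul_le _ _).trans_eq ?_
      rw [fourier_norm, one_mul]
    refine ne_top_of_le_ne_top ?_ (ENNReal.tsum_le_tsum hle)
    rw [ENNReal.tsum_mul_right, ENNReal.tsum_prod']
    simp_rw [ENNReal.tsum_mul_left, ENNReal.tsum_mul_right]
    have := h.ne
    simp only [flNorm] at this
    simp [ENNReal.mul_eq_top, this, hF]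
  have := fourierCoeff_tsum H hfin n
  simp_rw [hpt] at this
  rw [this]
  congr 1; ext p
  have h5 := fourierCoeff_fourier_mul (p.1 - p.2) n (F p.1 * (starRingEnd ℂ) (F p.2)) f
  have : n - p.1 + p.2 = n - (p.1 - p.2) := by ring
  rw [this]
  exact h5

/-- The continuous function with given absolutely summable Fourier coefficients. -/
def synth (a : Ell1) : C(Torus, ℂ) := ∑' k, a k • fourier k

lemma summable_synth (a : Ell1) : Summable fun k => a k • (fourier k : C(Torus, ℂ)) := by
  refine Summable.of_norm ?_
  simpa only [norm_smul, fourier_norm, mul_one] using summable_norm_ell1 a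

lemma synth_apply (a : Ell1) (x : Torus) : synth a x = ∑' k, a k * fourier k x := by
  have := ((ContinuousMap.evalCLM ℂ x).hasSum (summable_synth a).hasSum).tsum_eq
  exact this.symm

lemma fourierCoeff_synth (a : Ell1) (n : ℤ) : fourierCoeff (synth a) n = a n := by
  have h := fourierCoeff_tsum (fun k => a k • (fourier k : C(Torus, ℂ))) (by
    have h : ∀ k, ‖a k • (fourier k : C(Torus, ℂ))‖ₑ = ‖a k‖ₑ := by
      intro k; rw [enorm_smul, ← ofReal_norm (fourier k), fourier_norm]; simp
    simp [h, tsum_enorm_eq]) n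
  have h2 : (fun x => ∑' k, (a k • (fourier k : C(Torus, ℂ))) x) = synth a := by
    ext x; rw [synth_apply]; rfl
  rw [h2] at h
  rw [h, tsum_eq_single n]
  · have := fourierCoeff.const_smul (T := 2 * Real.pi) (fourier n) (a n) n
    rw [fourierCoeff_fourier] at this
    simpa using this
  · intro k hk
    have := fourierCoeff.const_smul (T := 2 * Real.pi) (fourier k) (a k) n
    rw [fourierCoeff_fourier] at this
    simpa [Pi.single_apply, hk.symm] using this

lemma flNorm_synth (a : Ell1) : flNorm (synth a) = ‖a‖ₑ := by
  simp [flNorm, fourierCoeff_synth, tsum_enorm_eq]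

lemma norm_apply_le_of_fourierCoeff {f : C(Torus, ℂ)} {a : Ell1}
    (h : ∀ k, ‖fourierCoeff f k‖ = ‖a k‖) (x : Torus) : ‖f x‖ ≤ ‖a‖ := by
  have hs : Summable fun k => ‖fourierCoeff f k‖ := by simpa [h] using summable_norm_ell1 a
  have h1 := has_pointwise_sum_fourier_series_of_summable hs.of_norm x
  rw [← h1.tsum_eq]
  refine tsum_of_norm_bounded (summable_norm_ell1 a).hasSum (fun k => ?_) |>.trans_eq ?_
  · rw [norm_smul, norm_fourier_apply, mul_one, h]
  · exact (norm_eq_tsum a).symm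

/-- The vector field in terms of the original Fourier coefficients. -/
lemma field_freeEvol (κ s : ℝ) (U : Ell1) (n : ℤ) :
    field κ s (freeEvol (-s) U) n = -(Complex.I * κ) * (osc s (n ^ 2) *
      ∑' p : ℤ × ℤ, U p.1 * (starRingEnd ℂ) (U p.2) * U (n - p.1 + p.2)) := by
  rw [field_apply]
  congr 1
  rw [cubic, ← tsum_mul_left]
  congr 1; ext p
  simp only [interaction, freeEvol_apply, map_mul, conj_osc, osc_neg_left, neg_neg]
  -- This identity matches the four free phases with the resonance phase of each interaction.
  have : n ^ 2 = resonance n p + p.1 ^ 2 + -p.2 ^ 2 + (n - p.1 + p.2) ^ 2 := by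
    rw [resonance_eq]; ring
  rw [this, osc_add, osc_add, osc_add]
  ring

/-! ### Solutions on the torus and in the interaction picture. -/

/-- A solution in the class of the Cauchy problem gives one in the interaction picture. -/
lemma IsSolution.exists_interaction {ε T : ℝ} (hT : 0 ≤ T) {u₀ : Torus → ℂ}
    {u : ℝ → C(Torus, ℂ)} (hu : IsSolution ε T u₀ u) :
    ∃ a : ℝ → Ell1, IsInteractionSolution (ε ^ 2) T a ∧
      ∀ t ∈ Icc 0 T, ∀ k, a t k = osc t (k ^ 2) * fourierCoeff (u t) k := by
  set U : ℝ → Ell1 := fun t => toEll1 (fourierCoeff (u t)) with hU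
  have hUk : ∀ t ∈ Icc 0 T, ∀ k, U t k = fourierCoeff (u t) k := fun t ht k =>
    toEll1_apply (hu.finite_flNorm t ht).ne k
  have hUc : ContinuousOn U (Icc 0 T) := by
    intro t ht
    have h := hu.continuous_flNorm t ht
    rw [ContinuousWithinAt, tendsto_iff_edist_tendsto_0]
    refine h.congr' ?_
    filter_upwards [self_mem_nhdsWithin] with s hs
    rw [edist_eq_enorm_sub, ← tsum_enorm_eq, flNorm]
    congr 1; ext k
    rw [fourierCoeff_sub, lp.coeFn_sub, Pi.sub_apply, hUk s hs, hUk t ht]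
  -- Extension by the end values, since `IsInteractionSolution` asks for continuity on all of ℝ.
  set V : ℝ → Ell1 := IccExtend hT ((Icc 0 T).domRestrict U) with hV
  have hVc : Continuous V := (continuousOn_iff_continuous_domRestrict.1 hUc).Icc_extend'
  have hVU : ∀ t ∈ Icc 0 T, V t = U t := fun t ht => by
    rw [hV, IccExtend_of_mem _ _ ht]; rfl
  refine ⟨fun t => freeEvol (-t) (V t), ⟨?_, ?_⟩, ?_⟩
  · exact continuous_freeEvol.comp (continuous_neg.prodMk hVc)
  · intro t ht k
    have ht' : t ∈ Icc 0 T := Ioo_subset_Icc_self ht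
    obtain ⟨d, hd, he⟩ := hu.equation t ht' k
    rw [field_freeEvol]
    have hnt : Icc 0 T ∈ 𝓝 t := Icc_mem_nhds ht.1 ht.2
    have hd' := (hasDerivAt_osc (k ^ 2) t).mul (hd.hasDerivAt hnt)
    rw [fourierCoeff_cubic _ (hu.finite_flNorm t ht')] at he
    have hval : ∀ k, V t k = fourierCoeff (u t) k := fun k => by rw [hVU t ht', hUk t ht']
    simp_rw [hval]
    refine (hd'.congr_deriv ?_).congr_of_eventuallyEq ?_
    · have hI : Complex.I * Complex.I = -1 := Complex.I_mul_I
      push_cast at he ⊢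
      linear_combination (-(Complex.I * osc t (k ^ 2))) * he + osc t (k ^ 2) * d * hI
    · filter_upwards [hnt] with s hs
      simp [osc_neg_left, hVU s hs, hUk s hs]
  · intro t ht k
    simp [osc_neg_left, hVU t ht, hUk t ht]

/-- Existence of a solution for small data on long intervals. -/
lemma exists_isSolution {ε T r η : ℝ} (hT : 0 ≤ T) (hr : 0 < r) {f : Ell1} (hf : ‖f‖ ≤ r)
    (hη : η < r) (hsmall : ε ^ 2 * (2 * (2 * r) ^ 3 + 6 * ε ^ 2 * (2 * r) ^ 5 * T) ≤ η) :
    ∃ v, IsSolution ε T (synth f) v := by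
  have hR : 0 < 2 * r := by positivity
  obtain ⟨b, hb0, hb⟩ := exists_truncated_solution (sq_nonneg ε) hR hT f
  have hbc : ContinuousOn b (Icc 0 T) := fun t ht => (hb t ht).continuousWithinAt
  set a : ℝ → Ell1 := IccExtend hT ((Icc 0 T).domRestrict b) with ha
  have hac : Continuous a := (continuousOn_iff_continuous_domRestrict.1 hbc).Icc_extend'
  have hab : ∀ t ∈ Icc 0 T, a t = b t := fun t ht => by
    rw [ha, IccExtend_of_mem _ _ ht]; rfl
  have h0 : (0 : ℝ) ∈ Icc 0 T := ⟨le_rfl, hT⟩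
  have ha0 : a 0 = f := by rw [hab 0 h0, hb0]
  have hderiv : ∀ t ∈ Icc 0 T, ‖a t‖ ≤ 2 * r → ∀ k,
      HasDerivWithinAt (fun s => a s k) (field (ε ^ 2) t (a t) k) (Icc 0 T) t := by
    intro t ht hle k
    have h1 := hb t ht
    rw [← hab t ht, retract_of_le hR hle] at h1
    have h2 : HasDerivWithinAt a (field (ε ^ 2) t (a t)) (Icc 0 T) t :=
      h1.congr (fun s hs => hab s hs) (hab t ht)
    exact (lp.evalCLM (𝕜 := ℝ) (E := fun _ : ℤ => ℂ) 1 k).hasFDerivAt.comp_hasDerivWithinAt t h2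
  -- The truncation at 2r is inactive while the norm stays below 2r. The bootstrap uses the equation
  -- only there, and it concludes that the truncation is never active on [0, T].
  have hbound := norm_le_of_bootstrap (sq_nonneg ε) hac (fun T' hT' hle => ⟨hac, fun t ht k => by
    have ht' : t ∈ Ioo 0 T := ⟨ht.1, ht.2.trans_le hT'.2⟩
    exact (hderiv t (Ioo_subset_Icc_self ht') (hle t (Ioo_subset_Icc_self ht)) k).hasDerivAt
      (Icc_mem_nhds ht'.1 ht'.2)⟩) (ha0 ▸ hf) hη hsmall
  refine ⟨fun t => synth (freeEvol t (a t)), ⟨?_, ?_, ?_, ?_⟩⟩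
  · intro x
    congr 2
    ext k
    simp [ha0]
  · intro t _
    rw [flNorm_synth]
    exact enorm_lt_top
  · intro t _
    have hc : Continuous fun s => freeEvol s (a s) :=
      continuous_freeEvol.comp (continuous_id.prodMk hac)
    have h1 := tendsto_iff_edist_tendsto_0.1 ((hc.tendsto t).mono_left
      (nhdsWithin_le_nhds (s := Icc 0 T)))
    refine h1.congr fun s => ?_
    rw [edist_eq_enorm_sub, ← tsum_enorm_eq, flNorm]
    congr 1; ext k
    rw [fourierCoeff_sub, lp.coeFn_sub, Pi.sub_apply, fourierCoeff_synth, fourierCoeff_synth]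
  · intro t ht n
    have hd := ((hasDerivAt_osc (-n ^ 2) t).hasDerivWithinAt (s := Icc 0 T)).mul
      (hderiv t ht (hbound t ht) n)
    refine ⟨_, hd.congr_of_mem (fun s _ => ?_) ht, ?_⟩
    · rw [fourierCoeff_synth]; rfl
    · have hfe : a t = freeEvol (-t) (freeEvol t (a t)) := by
        ext k
        simp only [freeEvol_apply, osc_neg_left, neg_neg]
        rw [← mul_assoc, mul_comm (osc t (k ^ 2)), osc_neg_mul, one_mul]
      have hF : field (ε ^ 2) t (a t) n = field (ε ^ 2) t (freeEvol (-t) (freeEvol t (a t))) n := by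
        rw [← hfe]
      rw [hF, field_freeEvol, fourierCoeff_cubic _ (by rw [flNorm_synth]; exact enorm_lt_top)]
      simp_rw [fourierCoeff_synth]
      have h1 := osc_neg_mul t (n ^ 2)
      set S := ∑' p : ℤ × ℤ, freeEvol t (a t) p.1 * (starRingEnd ℂ) (freeEvol t (a t) p.2)
          * freeEvol t (a t) (n - p.1 + p.2)
      have hI : Complex.I * Complex.I = -1 := Complex.I_mul_I
      simp only [freeEvol_apply]
      push_cast
      linear_combination (-(ε : ℂ) ^ 2 * S * Complex.I * Complex.I) * h1
        + (-(ε : ℂ) ^ 2 * S - osc t (-n ^ 2) * n ^ 2 * a t n) * hI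

/-! ### Approximation of the solution by explicit rotations. -/

lemma IsInteractionSolution.mono {κ T T' : ℝ} {a : ℝ → Ell1} (h : IsInteractionSolution κ T a)
    (hT : T' ≤ T) : IsInteractionSolution κ T' a :=
  ⟨h.continuous, fun t ht => h.hasDerivAt t ⟨ht.1, ht.2.trans_le hT⟩⟩

lemma norm_exp_sub_exp_le (x y : ℝ) :
    ‖Complex.exp (x * Complex.I) - Complex.exp (y * Complex.I)‖ ≤ |x - y| := by
  have h : Complex.exp (x * Complex.I) - Complex.exp (y * Complex.I)
      = Complex.exp (y * Complex.I) * (Complex.exp (Complex.I * ((x - y : ℝ) : ℂ)) - 1) := by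
    rw [mul_sub, ← Complex.exp_add, mul_one]; congr 2; push_cast; ring
  rw [h, norm_mul, Complex.norm_exp_ofReal_mul_I, one_mul]
  exact Real.norm_exp_I_mul_ofReal_sub_one_le

/-- The phase that the resonant self-interaction produces differs little from the one for constant
amplitudes. -/
lemma abs_integral_sub_le {κ T r η : ℝ} (hκ : 0 ≤ κ) (hT : 0 ≤ T) {w : ℝ → ℂ} {z : ℂ}
    (hw : Continuous w) (hz : ‖z‖ ≤ r) (hr : ∀ s ∈ Icc 0 T, ‖w s‖ ≤ 2 * r)
    (hη : ∀ s ∈ Icc 0 T, |‖w s‖ - ‖z‖| ≤ η) :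
    |κ * T * ‖z‖ ^ 2 - ∫ s in (0 : ℝ)..T, κ * ‖w s‖ ^ 2| ≤ 3 * r * η * κ * T := by
  have hc : κ * T * ‖z‖ ^ 2 = ∫ _ in (0 : ℝ)..T, κ * ‖z‖ ^ 2 := by
    rw [intervalIntegral.integral_const, smul_eq_mul]; ring
  have hη0 : 0 ≤ η := (abs_nonneg _).trans (hη 0 ⟨le_rfl, hT⟩)
  have hr0 : 0 ≤ r := (norm_nonneg _).trans hz
  rw [hc, ← intervalIntegral.integral_sub (by simp)
    (Continuous.intervalIntegrable (by fun_prop) _ _), ← Real.norm_eq_abs]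
  refine (intervalIntegral.norm_integral_le_of_norm_le_const
    (C := 3 * r * η * κ) fun s hs => ?_).trans_eq (by rw [sub_zero, abs_of_nonneg hT])
  rw [uIoc_of_le hT] at hs
  have hs' : s ∈ Icc 0 T := ⟨hs.1.le, hs.2⟩
  rw [Real.norm_eq_abs, ← mul_sub, sq_sub_sq, abs_mul, abs_of_nonneg hκ, abs_mul,
    abs_of_nonneg (by positivity), abs_sub_comm]
  have h1 := hr s hs'
  have h2 := hη s hs'
  calc κ * ((‖z‖ + ‖w s‖) * |‖w s‖ - ‖z‖|) ≤ κ * ((r + 2 * r) * η) := by gcongr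
    _ = _ := by ring

/-- Deterministic description of the solution: over long times only the phases of the Fourier
coefficients change, to leading order by an explicit rotation. -/
theorem IsMaximalSolution.approx {ε T r η : ℝ} (hT : 0 ≤ T) (hr : 0 < r) {f : Ell1}
    (hf : ‖f‖ ≤ r) (hη : η < r)
    (hsmall : ε ^ 2 * (2 * (2 * r) ^ 3 + 6 * ε ^ 2 * (2 * r) ^ 5 * T) ≤ η)
    {u : ℝ → C(Torus, ℂ)} (hu : IsMaximalSolution ε (synth f) u) :
    (∀ x, ‖u T x‖ ≤ r + η) ∧
    ‖∑' k : ℤ, osc T (-k ^ 2) * (Complex.exp ((ε ^ 2 * T * ‖f k‖ ^ 2 : ℝ) * Complex.I) * f k)‖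
      ≤ ‖u T 0‖ + η + 3 * r ^ 2 * η * ε ^ 2 * T := by
  have hsol := hu T hT (exists_isSolution hT hr hf hη hsmall)
  obtain ⟨a, ha, hau⟩ := hsol.exists_interaction hT
  have hη0 : 0 ≤ η := le_trans (by positivity) hsmall
  have hmT : T ∈ Icc 0 T := ⟨hT, le_rfl⟩
  have ha0 : ∀ k, a 0 k = f k := by
    intro k
    have : (u 0 : Torus → ℂ) = synth f := funext hsol.initial
    rw [hau 0 ⟨le_rfl, hT⟩, osc_zero_left, one_mul, this, fourierCoeff_synth]
  have ha0' : a 0 = f := by ext k; exact ha0 k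
  have hbd := norm_le_of_bootstrap (sq_nonneg ε) ha.continuous
    (fun T' hT' _ => ha.mono hT'.2) (ha0' ▸ hf) hη hsmall
  have hnf : ∀ t ∈ Icc 0 T,
      ∑' k, ‖gauge (ε ^ 2) a k t * a t k - a 0 k‖ₑ ≤ ENNReal.ofReal η := by
    intro t ht
    refine (tsum_enorm_gauge_mul_sub_le (sq_nonneg ε) ht.1 (ha.mono ht.2)
      (fun s hs => hbd s ⟨hs.1, hs.2.trans ht.2⟩)).trans (ENNReal.ofReal_le_ofReal ?_)
    refine le_trans ?_ hsmall
    have := ht.2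
    gcongr
  have hnorm : ∀ k, ‖fourierCoeff (u T) k‖ = ‖a T k‖ := by
    intro k; rw [hau T hmT]; simp
  refine ⟨fun x => (norm_apply_le_of_fourierCoeff hnorm x).trans
    (norm_le_add_of_gauge hη0 (ha0' ▸ hf) (hnf T hmT)), ?_⟩
  -- The mass part of the resonant phase is common to all modes: it is a global rotation, invisible
  -- in |u(T, 0)|. Only the phases ψ k have to be compared with ε²T|f_k|².
  set Φ : ℝ := ∫ s in (0 : ℝ)..T, ε ^ 2 * (2 * mass (a s)) with hΦ
  set ψ : ℤ → ℝ := fun k => ∫ s in (0 : ℝ)..T, ε ^ 2 * ‖a s k‖ ^ 2 with hψ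
  set b : ℤ → ℂ := fun k => gauge (ε ^ 2) a k T * a T k with hb
  have hcoord := fun k => (continuous_coord k).comp ha.continuous
  simp only [Function.comp_def] at hcoord
  have hmass := continuous_mass.comp ha.continuous
  simp only [Function.comp_def] at hmass
  have hphase : ∀ k, resPhase (ε ^ 2) a k T = Φ - ψ k := by
    intro k
    simp only [hΦ, hψ, resPhase]
    have h1 : Continuous fun s => ε ^ 2 * (2 * mass (a s)) := by fun_prop
    have h2 : Continuous fun s => ε ^ 2 * ‖a s k‖ ^ 2 :=
      continuous_const.mul ((hcoord k).norm.pow 2)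
    rw [← intervalIntegral.integral_sub (h1.intervalIntegrable _ _) (h2.intervalIntegrable _ _)]
    congr 1; ext s; ring
  have haT : ∀ k, Complex.exp (Φ * Complex.I) * a T k = Complex.exp (ψ k * Complex.I) * b k := by
    intro k
    simp only [hb, gauge, hphase]
    rw [← mul_assoc, ← Complex.exp_add]
    congr 2; push_cast; ring
  have hsT : Summable fun k => ‖fourierCoeff (u T) k‖ := by
    simpa [hnorm] using summable_norm_ell1 (a T)
  have hu0 := (has_pointwise_sum_fourier_series_of_summable hsT.of_norm 0).mul_left
    (Complex.exp (Φ * Complex.I))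
  have hterm : ∀ k, Complex.exp (Φ * Complex.I) * (fourierCoeff (u T) k • fourier k (0 : Torus))
      = osc T (-k ^ 2) * (Complex.exp (ψ k * Complex.I) * b k) := by
    intro k
    rw [← haT, hau T hmT, fourier_eval_zero, smul_eq_mul, mul_one]
    have := osc_neg_mul T (k ^ 2)
    linear_combination (-(Complex.exp (Φ * Complex.I) * fourierCoeff (u T) k)) * this
  simp_rw [hterm] at hu0
  set D : ℤ → ℂ := fun k => Complex.exp ((ε ^ 2 * T * ‖f k‖ ^ 2 : ℝ) * Complex.I) * f k with hD
  have hsD : Summable fun k => osc T (-k ^ 2) * D k := by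
    refine Summable.of_norm ?_
    simpa [hD, Complex.norm_exp_ofReal_mul_I, -Complex.ofReal_mul, -Complex.ofReal_pow]
      using summable_norm_ell1 f
  have hdb : ∑' k, ‖b k - f k‖ₑ ≤ ENNReal.ofReal η := by
    simpa [hb, ha0] using hnf T hmT
  -- Two errors per mode: replacing ψ k by its value for frozen moduli, and replacing b k by f k.
  have hdiff : ∀ k, ‖osc T (-k ^ 2) * D k - osc T (-k ^ 2) * (Complex.exp (ψ k * Complex.I) * b k)‖
      ≤ 3 * r * η * ε ^ 2 * T * ‖f k‖ + ‖b k - f k‖ := by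
    intro k
    have e : osc T (-k ^ 2) * D k - osc T (-k ^ 2) * (Complex.exp (ψ k * Complex.I) * b k)
        = osc T (-k ^ 2) * ((Complex.exp ((ε ^ 2 * T * ‖f k‖ ^ 2 : ℝ) * Complex.I)
          - Complex.exp (ψ k * Complex.I)) * f k - Complex.exp (ψ k * Complex.I) * (b k - f k)) := by
      simp only [hD]; ring
    rw [e, norm_mul, norm_osc, one_mul]
    refine (norm_sub_le _ _).trans (add_le_add ?_ ?_)
    · rw [norm_mul]
      refine mul_le_mul_of_nonneg_right ((norm_exp_sub_exp_le _ _).trans ?_) (norm_nonneg _)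
      refine abs_integral_sub_le (sq_nonneg ε) hT (hcoord k) ((norm_coord_le f k).trans hf)
        (fun s hs => (norm_coord_le _ k).trans (hbd s hs)) fun s hs => ?_
      have h1 : ‖gauge (ε ^ 2) a k s * a s k - a 0 k‖ₑ ≤ ENNReal.ofReal η :=
        (ENNReal.le_tsum k).trans (hnf s hs)
      rw [← ofReal_norm, ENNReal.ofReal_le_ofReal_iff hη0] at h1
      have h2 := abs_norm_sub_norm_le (gauge (ε ^ 2) a k s * a s k) (a 0 k)
      rw [norm_mul, norm_gauge, one_mul, ha0] at h2
      rw [ha0] at h1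
      exact h2.trans h1
    · rw [norm_mul, Complex.norm_exp_ofReal_mul_I, one_mul]
  have hsb : Summable fun k => ‖b k - f k‖ :=
    summable_norm_of_tsum_enorm (ne_top_of_le_ne_top ENNReal.ofReal_ne_top hdb)
  have hdb' : ∑' k, ‖b k - f k‖ ≤ η := by
    rw [← ENNReal.ofReal_le_ofReal_iff hη0,
      ENNReal.ofReal_tsum_of_nonneg (fun _ => norm_nonneg _) hsb]
    simpa using hdb
  have hkey := tsum_of_norm_bounded
    (((summable_norm_ell1 f).mul_left (3 * r * η * ε ^ 2 * T)).add hsb).hasSum hdiff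
  rw [hsD.tsum_sub hu0.summable, hu0.tsum_eq,
    ((summable_norm_ell1 f).mul_left (3 * r * η * ε ^ 2 * T)).tsum_add hsb, tsum_mul_left,
    ← norm_eq_tsum] at hkey
  have hu1 : ‖Complex.exp (Φ * Complex.I) * u T 0‖ = ‖u T 0‖ := by
    rw [norm_mul, Complex.norm_exp_ofReal_mul_I, one_mul]
  have htri := norm_sub_norm_le (∑' k : ℤ, osc T (-k ^ 2) * D k)
    (Complex.exp (Φ * Complex.I) * u T 0)
  have hlast : 3 * r * η * ε ^ 2 * T * ‖f‖ ≤ 3 * r ^ 2 * η * ε ^ 2 * T := by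
    calc _ ≤ 3 * r * η * ε ^ 2 * T * r := by gcongr
      _ = _ := by ring
  linarith


/-! ### The standard complex Gaussian. -/

lemma stdComplexGaussian_eq : stdComplexGaussian
    = ((gaussianReal 0 (1 / 2)).prod (gaussianReal 0 (1 / 2))).map
      Complex.measurableEquivRealProd.symm := by
  unfold stdComplexGaussian
  congr 1
  ext p
  simp [Complex.measurableEquivRealProd_symm_apply, Complex.mk_eq_add_mul_I]

instance : IsProbabilityMeasure stdComplexGaussian := by
  rw [stdComplexGaussian_eq]
  exact Measure.isProbabilityMeasure_map (MeasurableEquiv.measurable _).aemeasurable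

lemma gaussianPDFReal_half (x : ℝ) :
    gaussianPDFReal 0 (1 / 2) x = (√Real.pi)⁻¹ * Real.exp (-x ^ 2) := by
  rw [gaussianPDFReal_def]
  have h1 : 2 * Real.pi * ((1 / 2 : ℝ≥0) : ℝ) = Real.pi := by push_cast; ring
  have h2 : 2 * ((1 / 2 : ℝ≥0) : ℝ) = 1 := by push_cast; ring
  simp only [h1, h2, sub_zero, div_one]

/-- The product of the two real densities is the radial function π⁻¹e^{-|z|²}; rotation invariance
rests on this. -/
lemma lintegral_stdComplexGaussian {F : ℂ → ℝ≥0∞} (hF : Measurable F) :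
    ∫⁻ z, F z ∂stdComplexGaussian
      = ∫⁻ z, ENNReal.ofReal (Real.pi⁻¹ * Real.exp (-‖z‖ ^ 2)) * F z := by
  have hv : (1 / 2 : ℝ≥0) ≠ 0 := by norm_num
  have hpdf : Measurable (gaussianPDF 0 (1 / 2)) := measurable_gaussianPDF 0 (1 / 2)
  have hG : Measurable fun p => F (Complex.measurableEquivRealProd.symm p) :=
    hF.comp (MeasurableEquiv.measurable _)
  rw [stdComplexGaussian_eq, lintegral_map hF (MeasurableEquiv.measurable _),
    gaussianReal_of_var_ne_zero 0 hv, prod_withDensity_left hpdf, prod_withDensity_right hpdf,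
    lintegral_withDensity_eq_lintegral_mul _ (by fun_prop) hG,
    lintegral_withDensity_eq_lintegral_mul _ (by fun_prop) (by fun_prop)]
  rw [← Complex.volume_preserving_equiv_real_prod.symm.lintegral_comp (by fun_prop)]
  refine lintegral_congr fun p => ?_
  simp only [Pi.mul_apply, Complex.measurableEquivRealProd_symm_apply]
  rw [← mul_assoc]
  congr 1
  rw [gaussianPDF, gaussianPDF, ← ENNReal.ofReal_mul (gaussianPDFReal_nonneg _ _ _),
    gaussianPDFReal_half, gaussianPDFReal_half]
  congr 1
  have h1 : ‖(⟨p.1, p.2⟩ : ℂ)‖ ^ 2 = p.1 ^ 2 + p.2 ^ 2 := by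
    rw [← Complex.normSq_eq_norm_sq, Complex.normSq_mk]; ring
  have h2 : (√Real.pi)⁻¹ * (√Real.pi)⁻¹ = Real.pi⁻¹ := by
    rw [← mul_inv, Real.mul_self_sqrt Real.pi_pos.le]
  rw [h1, neg_add, Real.exp_add, ← h2]
  ring

/-- Rotation invariance of the complex Gaussian. -/
lemma lintegral_rotate (w : Circle) {F : ℂ → ℝ≥0∞} (hF : Measurable F) :
    ∫⁻ z, F (w * z) ∂stdComplexGaussian = ∫⁻ z, F z ∂stdComplexGaussian := by
  have h := (rotation w).measurePreserving.lintegral_comp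
    (f := fun z => ENNReal.ofReal (Real.pi⁻¹ * Real.exp (-‖z‖ ^ 2)) * F z) (by fun_prop)
  rw [lintegral_stdComplexGaussian hF, lintegral_stdComplexGaussian (by fun_prop), ← h]
  simp only [rotation_apply, norm_mul, Circle.norm_coe, one_mul]

/-- The law of the complex Gaussian is invariant under rotation by an angle that depends on the
modulus. -/
lemma stdComplexGaussian_twist {φ : ℝ → ℝ} (hφ : Measurable φ) {A : Set ℂ} (hA : MeasurableSet A) :
    stdComplexGaussian {z | Complex.exp (φ ‖z‖ * Complex.I) * z ∈ A} = stdComplexGaussian A := by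
  set F : ℂ → ℝ≥0∞ := A.indicator 1 with hF
  have hFm : Measurable F := measurable_one.indicator hA
  set τ : ℂ → ℂ := fun z => Complex.exp (φ ‖z‖ * Complex.I) * z with hτ
  have hτm : Measurable τ := by fun_prop
  have hL : stdComplexGaussian {z | τ z ∈ A} = ∫⁻ z, F (τ z) ∂stdComplexGaussian := by
    exact (lintegral_indicator_one (hτm hA)).symm
  have hRt : stdComplexGaussian A = ∫⁻ z, F z ∂stdComplexGaussian := by
    rw [← lintegral_indicator_one hA]
  -- By rotation invariance an integral may first be averaged over all rotations. For fixed z the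
  -- twist then acts as a translation of the circle by φ ‖z‖, which Haar measure ignores.
  have havg : ∀ G : ℂ → ℝ≥0∞, Measurable G → ∫⁻ z, G z ∂stdComplexGaussian
      = ∫⁻ z, ∫⁻ θ : Torus, G (θ.toCircle * z) ∂AddCircle.haarAddCircle ∂stdComplexGaussian := by
    intro G hG
    have hm : Measurable fun q : Torus × ℂ => G ((q.1.toCircle : ℂ) * q.2) := by
      refine hG.comp ?_
      have : Continuous fun q : Torus × ℂ => (q.1.toCircle : ℂ) * q.2 := by
        have := AddCircle.continuous_toCircle (T := 2 * Real.pi)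
        fun_prop
      exact this.measurable
    rw [← lintegral_lintegral_swap hm.aemeasurable]
    simp [lintegral_rotate _ hG]
  rw [hL, hRt, havg (fun z => F (τ z)) (hFm.comp hτm), havg _ hFm]
  refine lintegral_congr fun z => ?_
  rw [← lintegral_add_right_eq_self (μ := AddCircle.haarAddCircle)
    (fun θ : Torus => F (θ.toCircle * z)) ((φ ‖z‖ : ℝ) : Torus)]
  refine lintegral_congr fun θ => ?_
  congr 1
  simp only [hτ, norm_mul, Circle.norm_coe, one_mul, AddCircle.toCircle_add, Circle.coe_mul,
    AddCircle.toCircle_apply_mk, Circle.coe_exp]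
  have : 2 * Real.pi / (2 * Real.pi) * φ ‖z‖ = φ ‖z‖ := by
    rw [div_self Real.two_pi_pos.ne', one_mul]
  rw [this]; ring

/-- The density on [x, x + 1] is at least its value at x + 1. The loss of 1 in the exponent is of
lower order as x grows. -/
lemma gaussianReal_Ici_ge {x : ℝ} (hx : 0 ≤ x) :
    ENNReal.ofReal ((√Real.pi)⁻¹ * Real.exp (-(x + 1) ^ 2))
      ≤ gaussianReal 0 (1 / 2) (Ici x) := by
  have hv : (1 / 2 : ℝ≥0) ≠ 0 := by norm_num
  rw [gaussianReal_apply 0 hv]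
  calc _ = ∫⁻ _ in Icc x (x + 1), ENNReal.ofReal ((√Real.pi)⁻¹ * Real.exp (-(x + 1) ^ 2)) := by
        simp
    _ ≤ ∫⁻ y in Icc x (x + 1), gaussianPDF 0 (1 / 2) y := by
        refine setLIntegral_mono (measurable_gaussianPDF _ _) fun y hy => ?_
        rw [gaussianPDF, gaussianPDFReal_half]
        have hy0 : 0 ≤ y := hx.trans hy.1
        have := hy.2
        gcongr
    _ ≤ _ := lintegral_mono_set Icc_subset_Ici_self

lemma stdComplexGaussian_re_ge {x : ℝ} (hx : 0 ≤ x) :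
    ENNReal.ofReal ((√Real.pi)⁻¹ * Real.exp (-(x + 1) ^ 2))
      ≤ stdComplexGaussian {z | x ≤ z.re} := by
  rw [stdComplexGaussian_eq, MeasurableEquiv.map_apply]
  have : Complex.measurableEquivRealProd.symm ⁻¹' {z | x ≤ z.re} = Ici x ×ˢ univ := by
    ext p; simp [Complex.measurableEquivRealProd_symm_apply]
  rw [this, Measure.prod_prod, measure_univ, mul_one]
  exact gaussianReal_Ici_ge hx

lemma integrable_exp_sq_gaussianReal {a : ℝ} (ha : a < 1) :
    Integrable (fun x => Real.exp (a * x ^ 2)) (gaussianReal 0 (1 / 2)) := by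
  have hv : (1 / 2 : ℝ≥0) ≠ 0 := by norm_num
  rw [gaussianReal_of_var_ne_zero 0 hv, integrable_withDensity_iff (measurable_gaussianPDF _ _)
    (ae_of_all _ fun x => gaussianPDF_lt_top)]
  have h := (integrable_exp_neg_mul_sq (sub_pos.2 ha)).const_mul (√Real.pi)⁻¹
  refine h.congr (ae_of_all _ fun x => ?_)
  simp only [toReal_gaussianPDF, gaussianPDFReal_half]
  rw [mul_left_comm, ← Real.exp_add]
  congr 2; ring

lemma integrable_exp_sq_stdComplexGaussian {a : ℝ} (ha : a < 1) :
    Integrable (fun z : ℂ => Real.exp (a * ‖z‖ ^ 2)) stdComplexGaussian := by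
  rw [stdComplexGaussian_eq, integrable_map_equiv]
  refine ((integrable_exp_sq_gaussianReal ha).mul_prod (integrable_exp_sq_gaussianReal ha)).congr
    (ae_of_all _ fun p => ?_)
  simp only [Function.comp_def, Complex.measurableEquivRealProd_symm_apply]
  have h1 : ‖(⟨p.1, p.2⟩ : ℂ)‖ ^ 2 = p.1 ^ 2 + p.2 ^ 2 := by
    rw [← Complex.normSq_eq_norm_sq, Complex.normSq_mk]; ring
  rw [h1, ← Real.exp_add]
  congr 1; ring

lemma mul_le_sq_add {b : ℝ} (hb : 0 < b) (s x : ℝ) :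
    s * x ≤ b * s ^ 2 + (4 * b)⁻¹ * x ^ 2 := by
  have h : b * s ^ 2 + (4 * b)⁻¹ * x ^ 2 - s * x = b * (s - (2 * b)⁻¹ * x) ^ 2 := by
    field_simp; ring
  have : 0 ≤ b * (s - (2 * b)⁻¹ * x) ^ 2 := by positivity
  linarith

lemma integrable_exp_norm (s : ℝ) :
    Integrable (fun z : ℂ => Real.exp (s * ‖z‖)) stdComplexGaussian := by
  have h := (integrable_exp_sq_stdComplexGaussian (a := 1 / 2) (by norm_num)).const_mul
    (Real.exp (1 / 2 * s ^ 2))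
  refine h.mono' (by fun_prop) (ae_of_all _ fun z => ?_)
  rw [Real.norm_of_nonneg (Real.exp_pos _).le, ← Real.exp_add]
  have := mul_le_sq_add (b := 1 / 2) (by norm_num) s ‖z‖
  norm_num at this ⊢
  linarith

/-- Moment generating function of the modulus of a complex Gaussian. -/
lemma exists_mgf_bound {b : ℝ} (hb : 1 / 4 < b) :
    ∃ C : ℝ, 0 ≤ C ∧ ∀ s, 0 ≤ s →
      ∫ z, Real.exp (s * ‖z‖) ∂stdComplexGaussian ≤ Real.exp (b * s ^ 2 + C * s) := by
  have hb0 : 0 < b := by linarith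
  have ha : (4 * b)⁻¹ < 1 := inv_lt_one_of_one_lt₀ (by linarith)
  set K := ∫ z : ℂ, Real.exp ((4 * b)⁻¹ * ‖z‖ ^ 2) ∂stdComplexGaussian with hK
  set m := ∫ z : ℂ, Real.exp (1 * ‖z‖) ∂stdComplexGaussian with hm
  have hK0 : 0 ≤ K := integral_nonneg fun _ => (Real.exp_pos _).le
  have hm0 : 0 ≤ m := integral_nonneg fun _ => (Real.exp_pos _).le
  have hKe : K ≤ Real.exp K := by linarith [Real.add_one_le_exp K]
  refine ⟨K + m, by positivity, fun s hs => ?_⟩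
  -- The exponent has to vanish at s = 0, since a constant per mode would not be summable. For s ≤ 1
  -- convexity of exp gives 1 + sm; for s ≥ 1 Young's inequality gives a factor K ≤ e^K ≤ e^{Ks}.
  rcases le_total s 1 with h1 | h1
  · calc ∫ z, Real.exp (s * ‖z‖) ∂stdComplexGaussian
        ≤ ∫ z : ℂ, ((1 - s) + s * Real.exp (1 * ‖z‖)) ∂stdComplexGaussian := by
          refine integral_mono (integrable_exp_norm s)
            ((integrable_const _).add ((integrable_exp_norm 1).const_mul s)) fun z => ?_
          have := convexOn_exp.2 (mem_univ 0) (mem_univ ‖z‖) (sub_nonneg.2 h1) hs (by ring)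
          simpa using this
      _ = (1 - s) + s * m := by
          rw [integral_add (integrable_const _) ((integrable_exp_norm 1).const_mul s),
            integral_const_mul]
          simp [hm]
      _ ≤ s * m + 1 := by linarith
      _ ≤ Real.exp (s * m) := Real.add_one_le_exp _
      _ ≤ _ := by
        refine Real.exp_le_exp.2 ?_
        have : 0 ≤ b * s ^ 2 := by positivity
        have : 0 ≤ K * s := by positivity
        linarith
  · calc ∫ z, Real.exp (s * ‖z‖) ∂stdComplexGaussian
        ≤ ∫ z : ℂ, Real.exp (b * s ^ 2) * Real.exp ((4 * b)⁻¹ * ‖z‖ ^ 2)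
            ∂stdComplexGaussian := by
          refine integral_mono (integrable_exp_norm s)
            ((integrable_exp_sq_stdComplexGaussian ha).const_mul _) fun z => ?_
          simp only
          rw [← Real.exp_add]
          exact Real.exp_le_exp.2 (mul_le_sq_add hb0 s ‖z‖)
      _ = Real.exp (b * s ^ 2) * K := integral_const_mul _ _
      _ ≤ Real.exp (b * s ^ 2) * Real.exp K := by gcongr
      _ ≤ _ := by
        rw [← Real.exp_add]
        refine Real.exp_le_exp.2 ?_
        have : 0 ≤ m * s := by positivity
        nlinarith

/-! ### Chernoff bounds and alignment of finitely many modes. -/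

section Probability

variable {Ω : Type*} [MeasurableSpace Ω] {P : Measure Ω} {g : ℤ → Ω → ℂ}

/-- Chernoff bound for finitely many modes. -/
lemma finite_tail_le [IsProbabilityMeasure P] (hg_indep : iIndepFun g P)
    (hg_law : ∀ k, HasLaw (g k) stdComplexGaussian P)
    {c : ℤ → ℝ} (hc : ∀ k, 0 ≤ c k) {b C : ℝ} (hb : 0 ≤ b) (hC : 0 ≤ C)
    (hmgf : ∀ s, 0 ≤ s →
      ∫ z, Real.exp (s * ‖z‖) ∂stdComplexGaussian ≤ Real.exp (b * s ^ 2 + C * s))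
    {S L : ℝ} (F : Finset ℤ) (hS : ∑ k ∈ F, c k ^ 2 ≤ S) (hL : ∑ k ∈ F, c k ≤ L)
    {a l : ℝ} (hl : 0 ≤ l) :
    P.real {ω | a ≤ ∑ k ∈ F, c k * ‖g k ω‖}
      ≤ Real.exp (-l * a + (b * l ^ 2 * S + C * l * L)) := by
  set X : ℤ → Ω → ℝ := fun k ω => c k * ‖g k ω‖ with hX
  have hXi : iIndepFun X P := hg_indep.comp (fun k z => c k * ‖z‖) (fun k => by fun_prop)
  have hXm : ∀ k, AEMeasurable (X k) P := fun k =>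
    ((hg_law k).aemeasurable.norm).const_mul _
  have hXint : ∀ k, Integrable (fun ω => Real.exp (l * X k ω)) P := by
    intro k
    have h := integrable_exp_norm (l * c k)
    rw [← (hg_law k).map_eq] at h
    have := h.comp_aemeasurable (hg_law k).aemeasurable
    refine this.congr (ae_of_all _ fun ω => ?_)
    simp [hX, mul_assoc]
  have hXmgf : ∀ k, mgf (X k) P l ≤ Real.exp (b * l ^ 2 * c k ^ 2 + C * l * c k) := by
    intro k
    have h := (hg_law k).integral_comp (f := fun z => Real.exp (l * c k * ‖z‖))
      (integrable_exp_norm (l * c k)).aestronglyMeasurable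
    have h2 := hmgf (l * c k) (mul_nonneg hl (hc k))
    rw [← h] at h2
    simp only [mgf, hX]
    refine le_trans (le_of_eq ?_) (h2.trans (le_of_eq ?_))
    · simp [mul_assoc]
    · congr 1; ring
  have hsum : (fun ω => ∑ k ∈ F, c k * ‖g k ω‖) = ∑ k ∈ F, X k := by
    ext ω; simp [hX]
  have hint : Integrable (fun ω => Real.exp (l * (∑ k ∈ F, X k) ω)) P := by
    -- By independence the moment generating function of the sum is the product of positive ones,
    -- without any integrability of the sum. Were the exponential not integrable, it would have the
    -- default value 0.
    by_contra hcon
    have h1 := hXi.mgf_sum₀ hXm (t := l) F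
    rw [mgf_undef hcon] at h1
    have h2 : 0 < ∏ k ∈ F, mgf (X k) P l := Finset.prod_pos fun k _ => mgf_pos (hXint k)
    linarith
  have h := measure_ge_le_exp_mul_mgf (X := ∑ k ∈ F, X k) (μ := P) a hl hint
  rw [hXi.mgf_sum₀ hXm] at h
  rw [← hsum] at h
  refine h.trans ?_
  rw [Real.exp_add]
  refine mul_le_mul_of_nonneg_left ?_ (Real.exp_pos _).le
  calc ∏ k ∈ F, mgf (X k) P l ≤ ∏ k ∈ F, Real.exp (b * l ^ 2 * c k ^ 2 + C * l * c k) :=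
        Finset.prod_le_prod (fun k _ => mgf_nonneg) fun k _ => hXmgf k
    _ = Real.exp (b * l ^ 2 * ∑ k ∈ F, c k ^ 2 + C * l * ∑ k ∈ F, c k) := by
        rw [← Real.exp_sum, Finset.sum_add_distrib, Finset.mul_sum, Finset.mul_sum]
    _ ≤ _ := by gcongr

/-- Since the terms are nonnegative, the event lies in the increasing union of its finite analogues,
for which the Chernoff bound is uniform. A divergent sum is included in the event. -/
lemma tail_le [IsProbabilityMeasure P] (hg_indep : iIndepFun g P)
    (hg_law : ∀ k, HasLaw (g k) stdComplexGaussian P)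
    {c : ℤ → ℝ} (hc : ∀ k, 0 ≤ c k) (hcs : Summable c) (hcs2 : Summable fun k => c k ^ 2)
    {b C : ℝ} (hb : 0 ≤ b) (hC : 0 ≤ C)
    (hmgf : ∀ s, 0 ≤ s →
      ∫ z, Real.exp (s * ‖z‖) ∂stdComplexGaussian ≤ Real.exp (b * s ^ 2 + C * s))
    {a l : ℝ} (ha : 0 ≤ a) (hl : 0 ≤ l) :
    P {ω | ENNReal.ofReal a < ∑' k, ‖(c k : ℂ) * g k ω‖ₑ}
      ≤ ENNReal.ofReal
        (Real.exp (-l * a + (b * l ^ 2 * ∑' k, c k ^ 2 + C * l * ∑' k, c k))) := by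
  have hsub : {ω | ENNReal.ofReal a < ∑' k, ‖(c k : ℂ) * g k ω‖ₑ}
      ⊆ ⋃ F : Finset ℤ, {ω | a ≤ ∑ k ∈ F, c k * ‖g k ω‖} := by
    intro ω hω
    rw [mem_ofPred_eq, ENNReal.tsum_eq_iSup_sum, lt_iSup_iff] at hω
    obtain ⟨F, hF⟩ := hω
    refine mem_iUnion.2 ⟨F, ?_⟩
    have e : ∑ k ∈ F, ‖(c k : ℂ) * g k ω‖ₑ = ENNReal.ofReal (∑ k ∈ F, c k * ‖g k ω‖) := by
      rw [ENNReal.ofReal_sum_of_nonneg fun k _ => mul_nonneg (hc k) (norm_nonneg _)]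
      refine Finset.sum_congr rfl fun k _ => ?_
      rw [← ofReal_norm, norm_mul, Complex.norm_real, Real.norm_of_nonneg (hc k)]
    rw [e] at hF
    exact ((ENNReal.ofReal_lt_ofReal_iff_of_nonneg ha).1 hF).le
  have hmono : Monotone fun F : Finset ℤ => {ω | a ≤ ∑ k ∈ F, c k * ‖g k ω‖} := by
    intro F G hFG ω hω
    exact le_trans (show a ≤ _ from hω) (Finset.sum_le_sum_of_subset_of_nonneg hFG
      fun k _ _ => mul_nonneg (hc k) (norm_nonneg _))
  refine (measure_mono hsub).trans ?_
  rw [hmono.directed_le.measure_iUnion]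
  refine iSup_le fun F => ?_
  have h := finite_tail_le hg_indep hg_law hc hb hC hmgf F
    (hcs2.sum_le_tsum F fun k _ => sq_nonneg _) (hcs.sum_le_tsum F fun k _ => hc k) (a := a) hl
  rw [← ENNReal.ofReal_toReal (measure_ne_top P _)]
  exact ENNReal.ofReal_le_ofReal h

lemma summable_sq_of_nonneg {c : ℤ → ℝ} (hc : ∀ k, 0 ≤ c k) (hcs : Summable c) :
    Summable fun k => c k ^ 2 := by
  refine Summable.of_nonneg_of_le (fun _ => sq_nonneg _) (fun k => ?_) (hcs.mul_left (∑' k, c k))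
  rw [sq]
  exact mul_le_mul_of_nonneg_right (hcs.le_tsum k fun j _ => hc j) (hc k)

/-- Large deviation upper bound for the `𝓕L¹` norm of the initial datum. -/
theorem eventually_tail_le [IsProbabilityMeasure P] (hg_indep : iIndepFun g P)
    (hg_law : ∀ k, HasLaw (g k) stdComplexGaussian P)
    {c : ℤ → ℝ} (hc : ∀ k, 0 ≤ c k) (hcs : Summable c) {σ : ℝ} (hσ : ∑' k, c k ^ 2 < σ) :
    ∀ᶠ a in atTop, P {ω | ENNReal.ofReal a < ∑' k, ‖(c k : ℂ) * g k ω‖ₑ}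
      ≤ ENNReal.ofReal (Real.exp (-(a ^ 2 / σ))) := by
  have hcs2 := summable_sq_of_nonneg hc hcs
  set S := ∑' k, c k ^ 2 with hS
  set L := ∑' k, c k with hL
  have hS0 : 0 ≤ S := tsum_nonneg fun _ => sq_nonneg _
  have hσ0 : 0 < σ := hS0.trans_lt hσ
  -- The room between S and σ pays both for b > 1/4 and, below, for the term linear in a.
  obtain ⟨b, hb, hbS⟩ : ∃ b : ℝ, 1 / 4 < b ∧ 4 * b * S < σ := by
    refine ⟨1 / 4 + (σ - S) / (8 * (S + 1)), ?_, ?_⟩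
    · have : 0 < (σ - S) / (8 * (S + 1)) := div_pos (by linarith) (by positivity)
      linarith
    · have h1 : S / (S + 1) ≤ 1 := (div_le_one (by positivity)).2 (by linarith)
      have h2 : 4 * (1 / 4 + (σ - S) / (8 * (S + 1))) * S = S + (σ - S) / 2 * (S / (S + 1)) := by
        field_simp; ring
      rw [h2]
      nlinarith
  obtain ⟨C, hC, hmgf⟩ := exists_mgf_bound hb
  set θ := 4 * b * S / σ with hθ
  have hθ1 : θ < 1 := (div_lt_one hσ0).2 hbS
  filter_upwards [eventually_ge_atTop 0, eventually_ge_atTop (2 * C * L / (1 - θ))] with a ha ha2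
  -- The value l = 2a/σ minimises -la + l²σ/4, with minimum -a²/σ. As 4bS < σ, what is left over is
  -- negative for large a.
  refine (tail_le hg_indep hg_law hc hcs hcs2 (by linarith) hC hmgf ha
    (l := 2 * a / σ) (by positivity)).trans (ENNReal.ofReal_le_ofReal (Real.exp_le_exp.2 ?_))
  rw [div_le_iff₀ (by linarith)] at ha2
  have e : -(2 * a / σ) * a + (b * (2 * a / σ) ^ 2 * S + C * (2 * a / σ) * L)
      = -(a ^ 2 / σ) + a / σ * (2 * C * L - a * (1 - θ)) := by
    rw [hθ]; field_simp; ring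
  rw [← hS, ← hL, e]
  have : 0 ≤ a / σ := by positivity
  nlinarith

/-- Lower bound for the probability that finitely many rotated modes are aligned. -/
lemma aligned_ge (hg_indep : iIndepFun g P)
    (hg_law : ∀ k, HasLaw (g k) stdComplexGaussian P) (F : Finset ℤ) {x : ℤ → ℝ}
    (hx : ∀ k, 0 ≤ x k) {φ : ℤ → ℝ → ℝ} (hφ : ∀ k, Measurable (φ k)) :
    ENNReal.ofReal (∏ k ∈ F, ((√Real.pi)⁻¹ * Real.exp (-(x k + 1) ^ 2)))
      ≤ P {ω | ∀ k ∈ F, x k ≤ (Complex.exp (φ k ‖g k ω‖ * Complex.I) * g k ω).re} := by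
  set A : ℤ → Set ℂ := fun k => {z | x k ≤ (Complex.exp (φ k ‖z‖ * Complex.I) * z).re} with hA
  have hAm : ∀ k, MeasurableSet (A k) := fun k => by
    have := hφ k
    exact measurableSet_le measurable_const (by fun_prop)
  have h := hg_indep.measure_inter_preimage_eq_mul F (sets := A) fun k _ => hAm k
  have e : {ω | ∀ k ∈ F, x k ≤ (Complex.exp (φ k ‖g k ω‖ * Complex.I) * g k ω).re}
      = ⋂ k ∈ F, g k ⁻¹' A k := by
    ext ω; simp [hA]
  rw [e, h, ENNReal.ofReal_prod_of_nonneg fun k _ => by positivity]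
  refine Finset.prod_le_prod' fun k _ => ?_
  have h1 : P (g k ⁻¹' A k) = stdComplexGaussian (A k) := (hg_law k).measure_eq (hAm k)
  have h2 := stdComplexGaussian_twist (hφ k) (A := {z | x k ≤ z.re})
    (measurableSet_le measurable_const Complex.measurable_re)
  have h3 : stdComplexGaussian (A k) = stdComplexGaussian {z | x k ≤ z.re} := h2
  rw [h1, h3]
  exact stdComplexGaussian_re_ge (hx k)

end Probability


/-! ### The large deviation regime. -/

/-- The free and the nonlinear phase merge into one angle depending only on k and |γ_k|, the form to
which the twist invariance of the Gaussian applies. -/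
lemma IsMaximalSolution.approx_of_datum {ε T r η : ℝ} (hT : 0 ≤ T) (hr : 0 < r) {c : ℤ → ℝ}
    {γ : ℤ → ℂ} (hf : ∑' k, ‖(c k : ℂ) * γ k‖ₑ ≤ ENNReal.ofReal r) (hη : η < r)
    (hsmall : ε ^ 2 * (2 * (2 * r) ^ 3 + 6 * ε ^ 2 * (2 * r) ^ 5 * T) ≤ η)
    {u : ℝ → C(Torus, ℂ)} (hu : IsMaximalSolution ε (initialDatum c γ) u) :
    (∀ x, ‖u T x‖ ≤ r + η) ∧
    ‖∑' k : ℤ, (c k : ℂ) * (Complex.exp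
        ((-(T * k ^ 2) + ε ^ 2 * T * (c k * ‖γ k‖) ^ 2 : ℝ) * Complex.I) * γ k)‖
      ≤ ‖u T 0‖ + η + 3 * r ^ 2 * η * ε ^ 2 * T := by
  have hfin : ∑' k, ‖(c k : ℂ) * γ k‖ₑ ≠ ∞ := ne_top_of_le_ne_top ENNReal.ofReal_ne_top hf
  set f : Ell1 := toEll1 fun k => (c k : ℂ) * γ k with hfdef
  have hfk : ∀ k, f k = (c k : ℂ) * γ k := toEll1_apply hfin
  have hfr : ‖f‖ ≤ r := by
    rw [enorm_le_iff_tsum_enorm_le _ hr.le]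
    simpa [hfk] using hf
  have hu₀ : initialDatum c γ = synth f := by
    ext x
    rw [synth_apply]
    simp only [hfk]; rfl
  rw [hu₀] at hu
  obtain ⟨h1, h2⟩ := hu.approx hT hr hfr hη hsmall
  refine ⟨h1, le_trans (le_of_eq ?_) h2⟩
  congr 2
  ext k
  rw [hfk, norm_mul, Complex.norm_real, Real.norm_eq_abs, mul_pow |c k|, sq_abs, ← mul_pow,
    osc]
  have h : Complex.exp ((-(T * k ^ 2) + ε ^ 2 * T * (c k * ‖γ k‖) ^ 2 : ℝ) * Complex.I)
      = Complex.exp ((T * (-k ^ 2 : ℤ) : ℝ) * Complex.I)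
        * Complex.exp ((ε ^ 2 * T * (c k * ‖γ k‖) ^ 2 : ℝ) * Complex.I) := by
    rw [← Complex.exp_add]; congr 1; push_cast; ring
  rw [h]; ring

/-- The approximation of the solution in the large deviation regime. -/
lemma eventually_approx {t : ℝ → ℝ} (ht_nonneg : ∀ ε : ℝ, 0 < ε → 0 ≤ t ε)
    (ht : Tendsto (fun ε => √ε ^ 3 * t ε) (𝓝[>] 0) (𝓝 0)) (c : ℤ → ℝ) {ρ δ : ℝ}
    (hρ : 0 < ρ) (hδ : 0 < δ) :
    ∀ᶠ ε in 𝓝[>] (0 : ℝ), ∀ (γ : ℤ → ℂ) (u : ℝ → C(Torus, ℂ)),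
      IsMaximalSolution ε (initialDatum c γ) u →
      ∑' k, ‖(c k : ℂ) * γ k‖ₑ ≤ ENNReal.ofReal (ρ * (√ε)⁻¹) →
      (∀ x, ‖u (t ε) x‖ ≤ (ρ + δ) * (√ε)⁻¹) ∧
      ‖∑' k : ℤ, (c k : ℂ) * (Complex.exp
        ((-(t ε * k ^ 2) + ε ^ 2 * t ε * (c k * ‖γ k‖) ^ 2 : ℝ) * Complex.I) * γ k)‖
        ≤ ‖u (t ε) 0‖ + δ * (√ε)⁻¹ := by
  have hs : Tendsto (fun ε : ℝ => √ε) (𝓝[>] 0) (𝓝 0) := by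
    simpa using (Real.continuous_sqrt.tendsto 0).mono_left nhdsWithin_le_nhds
  -- With r = ρ/√ε, the normal form error divided by ε^{-1/2}: 16 = 2·2³ and 192 = 6·2⁵.
  have hq : Tendsto (fun ε => 16 * ρ ^ 3 * √ε ^ 2 + 192 * ρ ^ 5 * (√ε * (√ε ^ 3 * t ε)))
      (𝓝[>] 0) (𝓝 0) := by
    have := ((hs.pow 2).const_mul (16 * ρ ^ 3)).add ((hs.mul ht).const_mul (192 * ρ ^ 5))
    simpa using this
  -- The phase error 3r²ηε²T on the same scale: 48 = 3·16 and 576 = 3·192. Its last term is what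
  -- requires ε^{3/2} t(ε) → 0.
  have hq' : Tendsto (fun ε => 48 * ρ ^ 5 * (√ε * (√ε ^ 3 * t ε))
      + 576 * ρ ^ 7 * (√ε ^ 3 * t ε) ^ 2) (𝓝[>] 0) (𝓝 0) := by
    have := ((hs.mul ht).const_mul (48 * ρ ^ 5)).add ((ht.pow 2).const_mul (576 * ρ ^ 7))
    simpa using this
  filter_upwards [hq.eventually_lt_const (half_pos hδ), hq.eventually_lt_const hρ,
    hq'.eventually_lt_const (half_pos hδ), self_mem_nhdsWithin] with ε h1 h2 h3 hε γ u hu hγ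
  have hε0 : 0 < ε := hε
  set s := √ε with hsdef
  have hs0 : 0 < s := Real.sqrt_pos.2 hε0
  have hse : ε = s ^ 2 := (Real.sq_sqrt hε0.le).symm
  set q := 16 * ρ ^ 3 * s ^ 2 + 192 * ρ ^ 5 * (s * (s ^ 3 * t ε)) with hqdef
  set T := t ε with hT
  have hT0 : 0 ≤ T := ht_nonneg ε hε0
  have hsm : ε ^ 2 * (2 * (2 * (ρ * s⁻¹)) ^ 3 + 6 * ε ^ 2 * (2 * (ρ * s⁻¹)) ^ 5 * T)
      = q * s⁻¹ := by
    rw [hse, hqdef]; field_simp; ring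
  obtain ⟨ha, hb⟩ := hu.approx_of_datum hT0 (r := ρ * s⁻¹) (by positivity) hγ (η := q * s⁻¹)
    (by gcongr) hsm.le
  have hph : 3 * (ρ * s⁻¹) ^ 2 * (q * s⁻¹) * ε ^ 2 * T
      = (48 * ρ ^ 5 * (s * (s ^ 3 * T)) + 576 * ρ ^ 7 * (s ^ 3 * T) ^ 2) * s⁻¹ := by
    rw [hse, hqdef]; field_simp; ring
  have hsi : 0 < s⁻¹ := inv_pos.2 hs0
  refine ⟨fun x => (ha x).trans ?_, hb.trans ?_⟩
  · nlinarith
  · rw [hph]; nlinarith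

lemma hasSum_ite_mem {E : Type*} [AddCommMonoid E] [TopologicalSpace E] (F : Finset ℤ)
    (f : ℤ → E) : HasSum (fun k => if k ∈ F then f k else 0) (∑ k ∈ F, f k) := by
  have h : ∑ k ∈ F, f k = ∑ k ∈ F, if k ∈ F then f k else 0 :=
    Finset.sum_congr rfl fun k hk => (if_pos hk).symm
  rw [h]
  exact hasSum_sum_of_ne_finset_zero fun k hk => if_neg hk

/-- Aligned modes produce a large value. -/
lemma le_norm_tsum_of_aligned {c : ℤ → ℝ} (hc : ∀ k, 0 ≤ c k) {h : ℤ → ℂ} {x : ℤ → ℝ}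
    (F : Finset ℤ) (hx : ∀ k ∈ F, x k ≤ (h k).re) {δ : ℝ} (hδ : 0 ≤ δ)
    (hrest : ∑' k, ‖((if k ∈ F then 0 else c k : ℝ) : ℂ) * h k‖ₑ ≤ ENNReal.ofReal δ) :
    ∑ k ∈ F, c k * x k - δ ≤ ‖∑' k, (c k : ℂ) * h k‖ := by
  set w : ℤ → ℂ := fun k => ((if k ∈ F then 0 else c k : ℝ) : ℂ) * h k with hw
  have hsF : HasSum (fun k => if k ∈ F then (c k : ℂ) * h k else 0)
      (∑ k ∈ F, (c k : ℂ) * h k) :=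
    hasSum_ite_mem F _
  have hsw : Summable w := (summable_norm_of_tsum_enorm
    (ne_top_of_le_ne_top ENNReal.ofReal_ne_top hrest)).of_norm
  have heq : ∑' k, (c k : ℂ) * h k = ∑ k ∈ F, (c k : ℂ) * h k + ∑' k, w k := by
    rw [← hsF.tsum_eq, ← hsF.summable.tsum_add hsw]
    congr 1; ext k
    simp only [hw]; split_ifs <;> simp
  have hwn : ‖∑' k, w k‖ ≤ δ := by
    have := (enorm_tsum_le w).trans hrest
    rwa [← ofReal_norm, ENNReal.ofReal_le_ofReal_iff hδ] at this
  have hre : ∑ k ∈ F, c k * x k ≤ (∑ k ∈ F, (c k : ℂ) * h k).re := by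
    rw [Complex.re_sum]
    refine Finset.sum_le_sum fun k hk => ?_
    rw [Complex.re_ofReal_mul]
    exact mul_le_mul_of_nonneg_left (hx k hk) (hc k)
  have h1 := Complex.re_le_norm (∑ k ∈ F, (c k : ℂ) * h k)
  rw [heq]
  have h2 := norm_sub_norm_le (∑ k ∈ F, (c k : ℂ) * h k) (-∑' k, w k)
  rw [sub_neg_eq_add, norm_neg] at h2
  linarith

lemma tendsto_inv_sqrt : Tendsto (fun ε : ℝ => (√ε)⁻¹) (𝓝[>] 0) atTop := by
  refine tendsto_inv_nhdsGT_zero.comp (tendsto_nhdsWithin_iff.2 ⟨?_, ?_⟩)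
  · simpa using (Real.continuous_sqrt.tendsto 0).mono_left nhdsWithin_le_nhds
  · filter_upwards [self_mem_nhdsWithin] with ε hε
    exact Real.sqrt_pos.2 hε

/-! ### Upper and lower large deviation bounds. -/

section Probability

variable {Ω : Type*} [MeasurableSpace Ω] {P : Measure Ω} [IsProbabilityMeasure P] {g : ℤ → Ω → ℂ}

lemma eventually_tail_le_exp (hg_indep : iIndepFun g P)
    (hg_law : ∀ k, HasLaw (g k) stdComplexGaussian P)
    {c : ℤ → ℝ} (hc : ∀ k, 0 ≤ c k) (hcs : Summable c) {σ y B : ℝ} (hσ : ∑' k, c k ^ 2 < σ)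
    (hy : 0 < y) (hB : y ^ 2 = B * σ) :
    ∀ᶠ ε in 𝓝[>] (0 : ℝ),
      P {ω | ENNReal.ofReal (y * (√ε)⁻¹) < ∑' k, ‖(c k : ℂ) * g k ω‖ₑ}
        ≤ ENNReal.ofReal (Real.exp (-(B / ε))) := by
  have hσ0 : 0 < σ := (tsum_nonneg fun k => sq_nonneg (c k)).trans_lt hσ
  have h := (tendsto_inv_sqrt.const_mul_atTop hy).eventually
    (eventually_tail_le hg_indep hg_law hc hcs hσ)
  filter_upwards [h, self_mem_nhdsWithin] with ε h1 hε
  have hε0 : 0 < ε := hε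
  refine h1.trans_eq ?_
  congr 3
  rw [mul_pow, inv_pow, Real.sq_sqrt hε0.le, hB]
  field_simp

/-- Upper bound of the large deviation principle. -/
lemma eventually_upper (hg_indep : iIndepFun g P)
    (hg_law : ∀ k, HasLaw (g k) stdComplexGaussian P)
    {c : ℤ → ℝ} (hc : ∀ k, 0 ≤ c k) (hcs : Summable c)
    {u : ℝ → Ω → ℝ → C(Torus, ℂ)}
    (hu : ∀ ε : ℝ, 0 < ε → ∀ᵐ ω ∂P,
      IsMaximalSolution ε (initialDatum c (fun k => g k ω)) (u ε ω))
    {t : ℝ → ℝ} (ht_nonneg : ∀ ε : ℝ, 0 < ε → 0 ≤ t ε)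
    (ht : Tendsto (fun ε => √ε ^ 3 * t ε) (𝓝[>] 0) (𝓝 0)) {z₀ B : ℝ} (hz₀ : 0 < z₀)
    (hS : 0 < ∑' k, c k ^ 2) (hB : 0 < B) (hBz : B < z₀ ^ 2 / ∑' k, c k ^ 2) :
    ∀ᶠ ε in 𝓝[>] (0 : ℝ), P {ω | z₀ * (√ε)⁻¹ < ⨆ x, ‖u ε ω (t ε) x‖}
      ≤ ENNReal.ofReal (Real.exp (-(B / ε))) := by
  set S := ∑' k, c k ^ 2
  have h1 : S < z₀ ^ 2 / B := by
    rw [lt_div_iff₀ hS] at hBz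
    rw [lt_div_iff₀ hB]; linarith
  obtain ⟨σ, hσ1, hσ2⟩ := exists_between h1
  have hσ0 : 0 < σ := hS.trans hσ1
  -- The threshold at which the 𝓕L¹ tail with parameter σ has rate exactly B. As y < z₀, the gap z₀
  -- - y absorbs the approximation error.
  set y := √(B * σ) with hy
  have hy0 : 0 < y := Real.sqrt_pos.2 (by positivity)
  have hyz : y < z₀ := by
    rw [lt_div_iff₀ hB] at hσ2
    exact (Real.sqrt_lt' hz₀).2 (by linarith)
  filter_upwards [eventually_tail_le_exp hg_indep hg_law hc hcs hσ1 hy0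
    (Real.sq_sqrt (by positivity)), eventually_approx ht_nonneg ht c hy0 (sub_pos.2 hyz),
    self_mem_nhdsWithin] with ε h2 h3 hε
  refine le_trans (measure_mono_ae ?_) h2
  filter_upwards [hu ε hε] with ω hω hmem
  have hmem' : z₀ * (√ε)⁻¹ < ⨆ x, ‖u ε ω (t ε) x‖ := hmem
  refine lt_of_not_ge fun hle => ?_
  have h4 := (h3 _ _ hω hle).1
  rw [add_sub_cancel] at h4
  exact absurd (ciSup_le h4) (not_le.2 hmem')

lemma tsum_sq_off_finset {c : ℤ → ℝ} (hs : Summable fun k => c k ^ 2) (F : Finset ℤ) :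
    ∑' k, (if k ∈ F then 0 else c k) ^ 2 = ∑' k, c k ^ 2 - ∑ k ∈ F, c k ^ 2 := by
  have hF : HasSum (fun k => if k ∈ F then c k ^ 2 else 0) (∑ k ∈ F, c k ^ 2) :=
    hasSum_ite_mem F _
  rw [← hF.tsum_eq, ← hs.tsum_sub hF.summable]
  congr 1; ext k; split_ifs <;> simp

/-- The probability that finitely many modes are aligned, on the exponential scale. -/
lemma eventually_aligned_ge (F : Finset ℤ) (v : ℤ → ℝ) {B : ℝ}
    (hB : ∑ k ∈ F, v k ^ 2 < B) :
    ∀ᶠ ε in 𝓝[>] (0 : ℝ), Real.exp (-(B / ε))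
      ≤ ∏ k ∈ F, ((√Real.pi)⁻¹ * Real.exp (-(v k * (√ε)⁻¹ + 1) ^ 2)) := by
  have hs : Tendsto (fun ε : ℝ => √ε) (𝓝[>] 0) (𝓝 0) := by
    simpa using (Real.continuous_sqrt.tendsto 0).mono_left nhdsWithin_le_nhds
  have hlim : Tendsto (fun ε => ∑ k ∈ F, ((v k + √ε) ^ 2 + √ε ^ 2 * Real.log √Real.pi))
      (𝓝[>] 0) (𝓝 (∑ k ∈ F, v k ^ 2)) := by
    refine tendsto_finsetSum _ fun k _ => ?_
    have := ((hs.const_add (v k)).pow 2).add ((hs.pow 2).mul_const (Real.log √Real.pi))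
    simpa using this
  filter_upwards [hlim.eventually_lt_const hB, self_mem_nhdsWithin] with ε h1 hε
  have hε0 : 0 < ε := hε
  have hs0 : 0 < √ε := Real.sqrt_pos.2 hε0
  have hpi : 0 < √Real.pi := Real.sqrt_pos.2 Real.pi_pos
  have e : ∀ k, (√Real.pi)⁻¹ * Real.exp (-(v k * (√ε)⁻¹ + 1) ^ 2)
      = Real.exp (-(((v k + √ε) ^ 2 + √ε ^ 2 * Real.log √Real.pi) / √ε ^ 2)) := by
    intro k
    have : -(((v k + √ε) ^ 2 + √ε ^ 2 * Real.log √Real.pi) / √ε ^ 2)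
        = -Real.log √Real.pi + -(v k * (√ε)⁻¹ + 1) ^ 2 := by field_simp; ring
    rw [this, Real.exp_add, Real.exp_neg (Real.log _), Real.exp_log hpi]
  simp_rw [e]
  rw [← Real.exp_sum]
  refine Real.exp_le_exp.2 ?_
  rw [Finset.sum_neg_distrib, neg_le_neg_iff, ← Finset.sum_div, Real.sq_sqrt hε0.le]
  gcongr
  rw [Real.sq_sqrt hε0.le] at h1
  exact h1.le

/-- Lower bound of the large deviation principle. -/
lemma eventually_lower (hg_indep : iIndepFun g P)
    (hg_law : ∀ k, HasLaw (g k) stdComplexGaussian P)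
    {c : ℤ → ℝ} (hc : ∀ k, 0 ≤ c k) (hcs : Summable c)
    {u : ℝ → Ω → ℝ → C(Torus, ℂ)}
    (hu : ∀ ε : ℝ, 0 < ε → ∀ᵐ ω ∂P,
      IsMaximalSolution ε (initialDatum c (fun k => g k ω)) (u ε ω))
    {t : ℝ → ℝ} (ht_nonneg : ∀ ε : ℝ, 0 < ε → 0 ≤ t ε)
    (ht : Tendsto (fun ε => √ε ^ 3 * t ε) (𝓝[>] 0) (𝓝 0)) {z₀ B : ℝ} (hz₀ : 0 < z₀)
    (hS : 0 < ∑' k, c k ^ 2) (hBz : z₀ ^ 2 / ∑' k, c k ^ 2 < B) :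
    ∀ᶠ ε in 𝓝[>] (0 : ℝ), ENNReal.ofReal (Real.exp (-(B / ε)))
      ≤ P {ω | z₀ * (√ε)⁻¹ < ⨆ x, ‖u ε ω (t ε) x‖} := by
  have hcs2 := summable_sq_of_nonneg hc hcs
  set S := ∑' k, c k ^ 2 with hSdef
  obtain ⟨B', hB'1, hB'2⟩ := exists_between hBz
  have hB'0 : 0 < B' := lt_of_le_of_lt (by positivity) hB'1
  have hB0 : 0 < B := hB'0.trans hB'2
  obtain ⟨y, hy1, hy2⟩ : ∃ y, z₀ < y ∧ y ^ 2 < B' * S := by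
    rw [div_lt_iff₀ hS] at hB'1
    obtain ⟨y, h1, h2⟩ := exists_between (Real.lt_sqrt_of_sq_lt hB'1)
    exact ⟨y, h1, (Real.lt_sqrt (by linarith)).1 h2⟩
  have hy0 : 0 < y := hz₀.trans hy1
  -- One δ for the remaining modes, one for the approximation error, and one to keep the inequality
  -- strict.
  set δ := (y - z₀) / 3 with hδ
  have hδ0 : 0 < δ := by rw [hδ]; linarith
  -- F carries enough of the variance that aligning its modes up to height y costs less than B', and
  -- that the other modes exceed δ/√ε only with probability at most e^{-B/ε}.
  obtain ⟨F, hF1, hF2⟩ : ∃ F : Finset ℤ,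
      y ^ 2 / B' < ∑ k ∈ F, c k ^ 2 ∧ S - δ ^ 2 / B < ∑ k ∈ F, c k ^ 2 := by
    have h1 : y ^ 2 / B' < S := by rw [div_lt_iff₀ hB'0]; linarith
    have h2 : S - δ ^ 2 / B < S := by
      have : 0 < δ ^ 2 / B := by positivity
      linarith
    exact ((hcs2.hasSum.eventually_const_lt h1).and (hcs2.hasSum.eventually_const_lt h2)).exists
  set S' := ∑ k ∈ F, c k ^ 2 with hS'
  have hS'0 : 0 < S' := lt_trans (by positivity) hF1
  set c' : ℤ → ℝ := fun k => if k ∈ F then 0 else c k with hc'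
  have hc'0 : ∀ k, 0 ≤ c' k := fun k => by
    simp only [hc']; split_ifs
    exacts [le_rfl, hc k]
  have hc's : Summable c' := Summable.of_nonneg_of_le hc'0 (fun k => by
    simp only [hc']; split_ifs
    exacts [hc k, le_rfl]) hcs
  have hc'2 : ∑' k, c' k ^ 2 < δ ^ 2 / B := by
    have := tsum_sq_off_finset hcs2 F
    rw [this]; linarith
  -- Chosen so that a datum of 𝓕L¹ norm above ρ/√ε also has probability at most e^{-B/ε}; 2S is just
  -- a convenient number above S.
  set ρ := √(B * (2 * S)) with hρ
  have hρ0 : 0 < ρ := Real.sqrt_pos.2 (by positivity)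
  -- The minimiser of Σ v_k² under Σ c_k v_k = y over F, with minimum y²/S'.
  set v : ℤ → ℝ := fun k => y / S' * c k with hv
  have hv2 : ∑ k ∈ F, v k ^ 2 < B' := by
    simp only [hv, mul_pow]
    rw [← Finset.mul_sum, ← hS', div_pow]
    rw [div_lt_iff₀ hB'0] at hF1
    rw [div_mul_eq_mul_div, div_lt_iff₀ (by positivity)]
    nlinarith
  -- The gap between B' and B yields a factor 3: two units pay for `E₁` and `E₂`, and one is left
  -- for `E`.
  have hexp : ∀ᶠ ε in 𝓝[>] (0 : ℝ), 3 * Real.exp (-(B / ε)) ≤ Real.exp (-(B' / ε)) := by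
    have h1 : Tendsto (fun ε : ℝ => (B - B') * ε⁻¹) (𝓝[>] 0) atTop :=
      tendsto_inv_nhdsGT_zero.const_mul_atTop (by linarith)
    filter_upwards [h1.eventually_ge_atTop (Real.log 3)] with ε h
    calc 3 * Real.exp (-(B / ε)) = Real.exp (Real.log 3 + -(B / ε)) := by
          rw [Real.exp_add, Real.exp_log (by norm_num)]
      _ ≤ _ := Real.exp_le_exp.2 (by
        have : (B - B') * ε⁻¹ = B / ε - B' / ε := by ring
        linarith)
  filter_upwards [eventually_aligned_ge F v hv2, hexp,
    eventually_tail_le_exp hg_indep hg_law hc hcs (σ := 2 * S) (by linarith) hρ0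
      (Real.sq_sqrt (by positivity)),
    eventually_tail_le_exp hg_indep hg_law hc'0 hc's (B := B) hc'2 hδ0 (by field_simp),
    eventually_approx ht_nonneg ht c hρ0 hδ0, self_mem_nhdsWithin] with ε h1 h2 h3 h4 h5 hε
  have hε0 : 0 < ε := hε
  have hs0 : 0 < (√ε)⁻¹ := inv_pos.2 (Real.sqrt_pos.2 hε0)
  set T := t ε
  set φ : ℤ → ℝ → ℝ := fun k x => -(T * k ^ 2) + ε ^ 2 * T * (c k * x) ^ 2 with hφ
  have h6 := aligned_ge hg_indep hg_law F (x := fun k => v k * (√ε)⁻¹)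
    (fun k => by have := hc k; positivity) (φ := φ) (fun k => by fun_prop)
  set E := {ω | z₀ * (√ε)⁻¹ < ⨆ x, ‖u ε ω T x‖} with hE
  set E₁ := {ω | ENNReal.ofReal (ρ * (√ε)⁻¹) < ∑' k, ‖(c k : ℂ) * g k ω‖ₑ} with hE₁
  set E₂ := {ω | ENNReal.ofReal (δ * (√ε)⁻¹) < ∑' k, ‖(c' k : ℂ) * g k ω‖ₑ} with hE₂
  have hincl : P {ω | ∀ k ∈ F, v k * (√ε)⁻¹
      ≤ (Complex.exp (φ k ‖g k ω‖ * Complex.I) * g k ω).re} ≤ P (E ∪ E₁ ∪ E₂) := by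
    refine measure_mono_ae ?_
    filter_upwards [hu ε hε0] with ω hω hal
    have hal' : ∀ k ∈ F, v k * (√ε)⁻¹
      ≤ (Complex.exp (φ k ‖g k ω‖ * Complex.I) * g k ω).re := hal
    by_cases hω1 : ω ∈ E₁
    · exact Or.inl (Or.inr hω1)
    by_cases hω2 : ω ∈ E₂
    · exact Or.inr hω2
    refine Or.inl (Or.inl ?_)
    have hle1 : ∑' k, ‖(c k : ℂ) * g k ω‖ₑ ≤ ENNReal.ofReal (ρ * (√ε)⁻¹) := not_lt.1 hω1
    have hle2 : ∑' k, ‖(c' k : ℂ) * g k ω‖ₑ ≤ ENNReal.ofReal (δ * (√ε)⁻¹) := not_lt.1 hω2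
    obtain ⟨hbd, happ⟩ := h5 _ _ hω hle1
    have hex : ∀ k, ‖Complex.exp (φ k ‖g k ω‖ * Complex.I)‖ₑ = 1 := by
      intro k; rw [← ofReal_norm, Complex.norm_exp_ofReal_mul_I]; simp
    have hlow := le_norm_tsum_of_aligned hc F hal' (δ := δ * (√ε)⁻¹) (by positivity)
      (le_trans (le_of_eq (by simp only [enorm_mul, hex, one_mul, hc'])) hle2)
    have hcx : ∑ k ∈ F, c k * (v k * (√ε)⁻¹) = y * (√ε)⁻¹ := by
      have : ∀ k, c k * (v k * (√ε)⁻¹) = y / S' * (√ε)⁻¹ * c k ^ 2 := by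
        intro k; simp only [hv]; ring
      simp_rw [this]
      rw [← Finset.mul_sum, ← hS']
      field_simp
    rw [hcx] at hlow
    have hbdd : BddAbove (range fun x => ‖u ε ω T x‖) :=
      ⟨_, by rintro _ ⟨x, rfl⟩; exact hbd x⟩
    have hsup : ‖u ε ω T 0‖ ≤ ⨆ x, ‖u ε ω T x‖ := le_ciSup hbdd 0
    have hlow' := hlow.trans happ
    have hyz : y = z₀ + 3 * δ := by rw [hδ]; ring
    rw [hyz] at hlow'
    have : 0 < δ * (√ε)⁻¹ := by positivity
    show z₀ * (√ε)⁻¹ < _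
    nlinarith
  have hexpb : 0 ≤ Real.exp (-(B / ε)) := (Real.exp_pos _).le
  have hchain : ENNReal.ofReal (Real.exp (-(B / ε))) + (ENNReal.ofReal (Real.exp (-(B / ε)))
      + ENNReal.ofReal (Real.exp (-(B / ε))))
      ≤ P E + (ENNReal.ofReal (Real.exp (-(B / ε))) + ENNReal.ofReal (Real.exp (-(B / ε)))) := by
    calc _ = ENNReal.ofReal (3 * Real.exp (-(B / ε))) := by
          rw [← ENNReal.ofReal_add hexpb hexpb, ← ENNReal.ofReal_add hexpb (by positivity)]
          congr 1; ring
      _ ≤ P (E ∪ E₁ ∪ E₂) :=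
          (ENNReal.ofReal_le_ofReal (h2.trans h1)).trans (h6.trans hincl)
      _ ≤ P E + P E₁ + P E₂ :=
          (measure_union_le _ _).trans (by gcongr; exact measure_union_le _ _)
      _ ≤ _ := by rw [add_assoc]; gcongr
  exact (ENNReal.add_le_add_iff_right (by finiteness)).1 hchain

end Probability

/-- After multiplication by ε^{3/2} the bound becomes √ε |log ε|, which tends to 0. Besides t ≥ 0,
nothing else about the size of t is used. -/
lemma tendsto_sqrt_pow_mul_of_isBigO {t : ℝ → ℝ}
    (ht : t =O[𝓝[>] (0 : ℝ)] fun ε => ε⁻¹ * |Real.log ε|) :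
    Tendsto (fun ε => √ε ^ 3 * t ε) (𝓝[>] 0) (𝓝 0) := by
  have h1 : (fun ε => √ε ^ 3 * t ε) =O[𝓝[>] (0 : ℝ)]
      fun ε => √ε ^ 3 * (ε⁻¹ * |Real.log ε|) := (Asymptotics.isBigO_refl _ _).mul ht
  refine h1.trans_tendsto ?_
  have h2 := (tendsto_log_mul_rpow_nhdsGT_zero (r := 1 / 2) (by norm_num)).abs
  rw [abs_zero] at h2
  refine h2.congr' ?_
  filter_upwards [self_mem_nhdsWithin] with ε hε
  have hε0 : 0 < ε := hε
  have hs0 : 0 < √ε := Real.sqrt_pos.2 hε0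
  rw [← Real.sqrt_eq_rpow, abs_mul, abs_of_pos hs0]
  have : √ε ^ 3 * ε⁻¹ = √ε := by
    rw [pow_succ, Real.sq_sqrt hε0.le]; field_simp
  rw [← mul_assoc, this, mul_comm]

end WeakNLS

end

theorem corollary1p2 {Ω : Type*} [MeasurableSpace Ω] (P : Measure Ω) [IsProbabilityMeasure P]
    (g : ℤ → Ω → ℂ) (hg_indep : iIndepFun g P)
    (hg_law : ∀ k, HasLaw (g k) WeakNLS.stdComplexGaussian P)
    (c : ℤ → ℝ) (hc_nonneg : ∀ k, 0 ≤ c k) (hc_ne : ∃ k, c k ≠ 0) (hc : Summable c)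
    (u : ℝ → Ω → ℝ → C(WeakNLS.Torus, ℂ))
    (hu : ∀ ε : ℝ, 0 < ε → ∀ᵐ ω ∂P,
      WeakNLS.IsMaximalSolution ε (WeakNLS.initialDatum c (fun k => g k ω)) (u ε ω))
    (t : ℝ → ℝ) (ht_nonneg : ∀ ε : ℝ, 0 < ε → 0 ≤ t ε)
    (ht : t =O[𝓝[>] (0 : ℝ)] fun ε => ε⁻¹ * |Real.log ε|)
    (z₀ : ℝ) (hz₀ : 0 < z₀) :
    Tendsto
      (fun ε : ℝ => ε * Real.log (P.real {ω | z₀ * ε ^ (-(1 / 2) : ℝ) < ⨆ x, ‖u ε ω (t ε) x‖}))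
      (𝓝[>] (0 : ℝ)) (𝓝 (-(z₀ ^ 2 / ∑' k, c k ^ 2))) := by
  have hc2 : Summable fun k => c k ^ 2 := WeakNLS.summable_sq_of_nonneg hc_nonneg hc
  have hS : 0 < ∑' k, c k ^ 2 := by
    obtain ⟨k, hk⟩ := hc_ne
    exact hc2.tsum_pos (fun _ => sq_nonneg _) k (by positivity)
  have ht' := WeakNLS.tendsto_sqrt_pow_mul_of_isBigO ht
  have hz : 0 < z₀ ^ 2 / ∑' k, c k ^ 2 := by positivity
  have hlow := fun (B : ℝ) (hB : z₀ ^ 2 / ∑' k, c k ^ 2 < B) => WeakNLS.eventually_lower hg_indep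
    hg_law hc_nonneg hc hu ht_nonneg ht' hz₀ hS hB
  have hpow : ∀ ε ∈ Ioi (0 : ℝ), (√ε)⁻¹ = ε ^ (-(1 / 2) : ℝ) := fun ε hε => by
    rw [Real.rpow_neg (le_of_lt hε), Real.sqrt_eq_rpow]
  suffices h : Tendsto
      (fun ε : ℝ => ε * Real.log (P.real {ω | z₀ * (√ε)⁻¹ < ⨆ x, ‖u ε ω (t ε) x‖}))
      (𝓝[>] (0 : ℝ)) (𝓝 (-(z₀ ^ 2 / ∑' k, c k ^ 2))) by
    refine h.congr' ?_
    filter_upwards [self_mem_nhdsWithin] with ε hε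
    rw [hpow ε hε]
  rw [tendsto_order]
  constructor
  · intro b hb
    obtain ⟨B, hB1, hB2⟩ := exists_between (lt_neg_of_lt_neg hb)
    filter_upwards [hlow B hB1, self_mem_nhdsWithin] with ε h hε
    have hε0 : 0 < ε := hε
    have h1 : Real.exp (-(B / ε)) ≤ P.real _ :=
      (ENNReal.ofReal_le_iff_le_toReal (measure_ne_top P _)).1 h
    have h2 := (Real.le_log_iff_exp_le ((Real.exp_pos _).trans_le h1)).2 h1
    have h3 := mul_le_mul_of_nonneg_left h2 hε0.le
    have h4 : ε * -(B / ε) = -B := by field_simp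
    linarith
  · intro b hb
    -- The maximum with 0 is there because the upper bound requires B > 0.
    obtain ⟨B, hB1, hB2⟩ := exists_between (max_lt (neg_lt_of_neg_lt hb) hz)
    have hB0 : 0 < B := (le_max_right _ _).trans_lt hB1
    -- The lower bound, at an arbitrary rate, serves only to make the probability positive, so that
    -- its logarithm is not the default value at 0.
    filter_upwards [hlow _ (lt_add_one _), WeakNLS.eventually_upper hg_indep
      hg_law hc_nonneg hc hu ht_nonneg ht' hz₀ hS hB0 hB2, self_mem_nhdsWithin] with ε h h' hε
    have hε0 : 0 < ε := hε
    have h0 : 0 < P.real _ := (Real.exp_pos _).trans_le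
      ((ENNReal.ofReal_le_iff_le_toReal (measure_ne_top P _)).1 h)
    have h1 : P.real _ ≤ Real.exp (-(B / ε)) :=
      ENNReal.toReal_le_of_le_ofReal (Real.exp_pos _).le h'
    have h2 := (Real.log_le_iff_le_exp h0).2 h1
    have h3 := mul_le_mul_of_nonneg_left h2 hε0.le
    have h4 : ε * -(B / ε) = -B := by field_simp
    have h5 := (le_max_left (-b) 0).trans_lt hB1
    linarith
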